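/- **Setting.** Let $(\Omega,\mathcal F,\mathsf P)$ be an atomless probability space (every measurable set of positive probability has a measurable subset of strictly smaller positive probability). A *concave distortion* is a concave increasing function $\Psi:[0,1]\to[0,1]$ with $\Psi(0)=0$, $\Psi(1)=1$ (a jump at $0$ is allowed). Let $(\Psi_t)_{t\ge0}$ be a *concave distortion semigroup*, i.e. a family of concave distortions with $\Psi_s\circ\Psi_t=\Psi_{s+t}$ for all $s,t\ge0$, and exclude the trivial cases: $\Psi_t(x)=x$ for all $t\ge0$, $x\in[0,1]$; and $\Psi_t(x)=1$ for all $t>0$, $x\in(0,1]$. For a random variable $X$ with distribution function $D_X$, put $$\int_{\mathbb R}x\,d(\Psi_t(D_X(x)))=\int x^+\,d(\Psi_t(D_X(x)))-\int x^-\,d(\Psi_t(D_X(x))),\qquad \infty-\infty=-\infty,$$ a Lebesgue–Stieltjes integral in which the mass $\lim_{x\to-\infty}\Psi_t(D_X(x))$ is placed at $-\infty$ (so that $\int x^-d(\Psi_t(D_X(x)))=\infty$ if this mass is positive). Let $$\alpha(X)=\sup\Bigl\{t\ge0:\int_{\mathbb R}x\,d(\Psi_t(D_X(x)))\ge0\Bigr\}\in[0,\infty],\qquad\sup\emptyset=0,$$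 let $L^1(\alpha)$ be the set of random variables $X$ such that $\int_{\mathbb R}x\,d(\Psi_t(D_X(x)))>-\infty$ and $\int_{\mathbb R}x\,d(\Psi_t(D_{-X}(x)))>-\infty$ for all $t\ge0$, and let $\mathcal D_t$ be the set of probability measures $\mathsf Q\ll\mathsf P$ with $$\mathsf E\Bigl(\frac{d\mathsf Q}{d\mathsf P}-x\Bigr)^+\le\sup_{y\in[0,1]}\bigl[\Psi_t(y)-xy\bigr]\qquad\text{for all }x\ge0.$$ Expectations are understood as $\mathsf E_{\mathsf Q}X=\mathsf E_{\mathsf Q}X^+-\mathsf E_{\mathsf Q}X^-$ with $\infty-\infty=-\infty$. **Proposition.** The generator $$G(x)=\lim_{t\downarrow0}\frac{\Psi_t(x)-x}{t}$$ exists in $(0,\infty)$ for every $x\in(0,1)$, and for every $\varepsilon\in(0,1)$ the following conditions are equivalent: (a) there exists a random variable $X$ with $\operatorname{ess\,inf}X=-\infty$ and $\alpha(X)>0$; (b) for every $X\in L^1(\alpha)$ and every $t\ge0$, the set $\operatorname{argmin}_{\mathsf Q\in\mathcal D_t}\mathsf E_{\mathsf Q}X$ of extreme measures is nonempty; (c)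 $\Psi_t(0+)=0$ for every $t\ge0$; (d) $\displaystyle\int_0^\varepsilon\frac1{G(s)}\,ds=\infty$. -/

import Mathlib

open MeasureTheory ProbabilityTheory Filter Topology Set
open scoped NNReal ENNReal

/-- A concave distortion: a concave increasing function `[0,1] → [0,1]` with values `0` at `0` and
`1` at `1` (it may jump at `0`). It is represented by a function on `ℝ`, of which only the values on
`[0,1]` matter; that it maps `[0,1]` to `[0,1]` follows from monotonicity and the end values. -/
structure ConcaveDistortion where
  /-- the underlying function -/
  toFun : ℝ → ℝ
  concaveOn : ConcaveOn ℝ (Icc 0 1) toFun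
  monotoneOn : MonotoneOn toFun (Icc 0 1)
  map_zero : toFun 0 = 0
  map_one : toFun 1 = 1

instance : CoeFun ConcaveDistortion (fun _ => ℝ → ℝ) := ⟨ConcaveDistortion.toFun⟩

/-- A concave distortion semigroup: a family `(Ψ_t)_{t ≥ 0}` of concave distortions with
`Ψ_s ∘ Ψ_t = Ψ_{s+t}` on `[0,1]`. -/
structure DistortionSemigroup where
  /-- the distortion at time `t` -/
  toFun : ℝ≥0 → ConcaveDistortion
  comp_eq : ∀ s t : ℝ≥0, ∀ x ∈ Icc (0 : ℝ) 1, toFun s (toFun t x) = toFun (s + t) x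

instance : CoeFun DistortionSemigroup (fun _ => ℝ≥0 → ConcaveDistortion) :=
  ⟨DistortionSemigroup.toFun⟩

/-- The semigroup is neither the identity nor, at all positive times, identically `1` on `(0,1]`. -/
def DistortionSemigroup.IsNontrivial (Ψ : DistortionSemigroup) : Prop :=
  (¬ ∀ t : ℝ≥0, ∀ x ∈ Icc (0 : ℝ) 1, Ψ t x = x) ∧
  (¬ ∀ t : ℝ≥0, 0 < t → ∀ x ∈ Ioc (0 : ℝ) 1, Ψ t x = 1)

/-- The generator `G(x) = lim_{t ↓ 0} (Ψ_t(x) - x) / t` for `x ∈ (0,1)`, and `0` elsewhere. -/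
noncomputable def DistortionSemigroup.generator (Ψ : DistortionSemigroup) (x : ℝ) : ℝ :=
  open Classical in
  if x ∈ Ioo (0 : ℝ) 1 then limUnder (𝓝[>] (0 : ℝ≥0)) (fun t => (Ψ t x - x) / (t : ℝ)) else 0

theorem ConcaveDistortion.monotone_comp_cdf (ψ : ConcaveDistortion) (μ : Measure ℝ) :
    Monotone (fun x => ψ (cdf μ x)) := fun x y hxy =>
  ψ.monotoneOn ⟨cdf_nonneg μ x, cdf_le_one μ x⟩ ⟨cdf_nonneg μ y, cdf_le_one μ y⟩
    (monotone_cdf μ hxy)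

/-- The restriction to `ℝ` of the distorted law: the Lebesgue-Stieltjes measure `d(ψ(D(x)))`, where
`D` is the distribution function of the law `μ`. -/
noncomputable def ConcaveDistortion.distortedLaw (ψ : ConcaveDistortion) (μ : Measure ℝ) :
    Measure ℝ :=
  (ψ.monotone_comp_cdf μ).stieltjesFunction.measure

/-- The mass that `d(ψ(D(x)))` puts at `-∞`, i.e. the limit of `ψ(D(x))` as `x → -∞`. It is positive
when `ψ` jumps at `0` and the law is unbounded below. (There is no mass at `+∞`, as `ψ` is
continuous at `1`.) -/
noncomputable def ConcaveDistortion.massAtBot (ψ : ConcaveDistortion) (μ : Measure ℝ) : ℝ≥0∞ :=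
  ⨅ x : ℝ, ENNReal.ofReal (ψ (cdf μ x))

/-- `∫ x d(ψ(D(x))) = ∫ x⁺ d(ψ(D(x))) - ∫ x⁻ d(ψ(D(x)))`. The subtraction of `EReal` follows the
convention `∞ - ∞ = -∞`, and `∞ * 0 = 0` in `ℝ≥0∞`. -/
noncomputable def ConcaveDistortion.distortedMean (ψ : ConcaveDistortion) (μ : Measure ℝ) : EReal :=
  ((∫⁻ x, ENNReal.ofReal x ∂(ψ.distortedLaw μ) : ℝ≥0∞) : EReal) -
    (((∫⁻ x, ENNReal.ofReal (-x) ∂(ψ.distortedLaw μ)) + ∞ * ψ.massAtBot μ : ℝ≥0∞) : EReal)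

/-- The function `Φ(x) = sup_{y ∈ [0,1]} (ψ(y) - x y)`. -/
noncomputable def ConcaveDistortion.conj (ψ : ConcaveDistortion) (x : ℝ) : ℝ :=
  ⨆ y : Icc (0 : ℝ) 1, (ψ (y : ℝ) - x * (y : ℝ))

section Space

variable {Ω : Type*} [MeasurableSpace Ω]

/-- A measure is atomless if every measurable set of positive measure has a measurable subset of
strictly smaller positive measure. -/
def IsAtomless (P : Measure Ω) : Prop :=
  ∀ A : Set Ω, MeasurableSet A → 0 < P A → ∃ B ⊆ A, MeasurableSet B ∧ 0 < P B ∧ P B < P A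

/-- The expectation `E_Q X = E_Q X⁺ - E_Q X⁻` of an arbitrary random variable, with the convention
`∞ - ∞ = -∞`. -/
noncomputable def extendedMean (Q : Measure Ω) (X : Ω → ℝ) : EReal :=
  ((∫⁻ ω, ENNReal.ofReal (X ω) ∂Q : ℝ≥0∞) : EReal) -
    ((∫⁻ ω, ENNReal.ofReal (-X ω) ∂Q : ℝ≥0∞) : EReal)

/-- The set of probability measures `Q ≪ P` with `E (dQ/dP - x)⁺ ≤ Φ(x)` for all `x ≥ 0`. -/
def ConcaveDistortion.determiningSet (ψ : ConcaveDistortion) (P : Measure Ω) : Set (Measure Ω) :=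
  {Q | IsProbabilityMeasure Q ∧ Q ≪ P ∧ ∀ x : ℝ, 0 ≤ x →
    ∫⁻ ω, (Q.rnDeriv P ω - ENNReal.ofReal x) ∂P ≤ ENNReal.ofReal (ψ.conj x)}

/-- The set of extreme measures `argmin_{Q ∈ D} E_Q X`. -/
def extremeMeasures (D : Set (Measure Ω)) (X : Ω → ℝ) : Set (Measure Ω) :=
  {Q | Q ∈ D ∧ ∀ R ∈ D, extendedMean Q X ≤ extendedMean R X}

/-- The index `α(X) = sup {t ≥ 0 : ∫ x d(Ψ_t(D_X(x))) ≥ 0} ∈ [0,∞]`, where `sup ∅ = 0`. -/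
noncomputable def DistortionSemigroup.index (Ψ : DistortionSemigroup) (P : Measure Ω) (X : Ω → ℝ) :
    ℝ≥0∞ :=
  ⨆ (t : ℝ≥0) (_ : 0 ≤ (Ψ t).distortedMean (P.map X)), (t : ℝ≥0∞)

/-- The space `L¹(α)` of random variables `X` such that the distorted means of `X` and of `-X` are
greater than `-∞` at all times. -/
def DistortionSemigroup.L1 (Ψ : DistortionSemigroup) (P : Measure Ω) : Set (Ω → ℝ) :=
  {X | Measurable X ∧ ∀ t : ℝ≥0, ⊥ < (Ψ t).distortedMean (P.map X) ∧
    ⊥ < (Ψ t).distortedMean (P.map (fun ω => -X ω))}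

end Space

/-!
The condition `Ψ_t(0+) = 0` for all `t` is compared with each of the other three.

*Generator and integral condition.* The limit of `Ψ_t` at `t ↓ 0` is an idempotent concave distortion,
and the only ones are the identity and the function that is `1` on `(0,1]`; nontriviality leaves the
identity, so trajectories `t ↦ Ψ_t(x)` are continuous. As `(Ψ_t(y) - y) / y` is nonincreasing and
`(Ψ_t(y) - y) / (1 - y)` nondecreasing in `y`, the increments along a trajectory near `x` are all
comparable, with constants tending to `1`; this squeezes the difference quotients
(`IsNontrivial.exists_tendsto`). The generator `G` is concave and positive, hence continuous, and a
trajectory solves `u' = G(u)`, so that `∫ 1/G` over `[x, Ψ_T(x)]` equals `T`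
(`IsNontrivial.integral_one_div_generator`). Hence `∫ 1/G` near `0` is finite exactly when trajectories
that start close to `0` reach a fixed level in bounded time, i.e. when some `Ψ_t` jumps at `0`.

*Determining sets.* A probability measure `Q` is in the determining set of `ψ` if and only if
`Q ≤ ψ ∘ P` on all events (`apply_le_of_mem_determiningSet`, `mem_determiningSet`). If `ψ` is
continuous, the distorted law `d(ψ(D_X))` satisfies this domination on the real line
(`distortedLaw_apply_le`), so it is the law of `X` under a member `Q` of the determining set, whose
density is a function of `X`. By the domination, `X` is stochastically smallest under `Q` among all
members; so `Q` is an extreme measure and the distorted mean of `X` is `E_Q X`.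

*Necessity of continuity.* If `ψ` jumps at `0`, a random variable that is unbounded below gets a mass
at `-∞` and has distorted mean `-∞`. Moreover, an `X > 0` with essential infimum `0` has no extreme
measure: members of the determining set of `ψ` made linear near `0` put nearly the mass of the jump
close to `{X = 0}`, whereas any single `Q ≪ P` does not (`not_nonempty_extremeMeasures`). Atomlessness
provides unbounded random variables with arbitrarily small tails.
-/

/-! ### Concave distortions and the generator -/

namespace ConcaveDistortion

variable (ψ : ConcaveDistortion)

theorem le_apply {x : ℝ} (hx : x ∈ Icc (0 : ℝ) 1) : x ≤ ψ x := by
  have h := ψ.concaveOn.2 (show (0 : ℝ) ∈ Icc (0 : ℝ) 1 by simp)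
    (show (1 : ℝ) ∈ Icc (0 : ℝ) 1 by simp)
    (sub_nonneg.2 hx.2) hx.1 (by ring)
  simpa [ψ.map_zero, ψ.map_one] using h

theorem nonneg {x : ℝ} (hx : x ∈ Icc (0 : ℝ) 1) : 0 ≤ ψ x := hx.1.trans (ψ.le_apply hx)

theorem le_one {x : ℝ} (hx : x ∈ Icc (0 : ℝ) 1) : ψ x ≤ 1 := by
  simpa [ψ.map_one] using ψ.monotoneOn hx (show (1 : ℝ) ∈ Icc (0 : ℝ) 1 by simp) hx.2

theorem mem_Icc {x : ℝ} (hx : x ∈ Icc (0 : ℝ) 1) : ψ x ∈ Icc (0 : ℝ) 1 :=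
  ⟨ψ.nonneg hx, ψ.le_one hx⟩

/-- `ψ(x) / x` is nonincreasing. -/
theorem apply_mul_le {x y : ℝ} (hx : 0 ≤ x) (hxy : x ≤ y) (hy : y ≤ 1) : ψ y * x ≤ ψ x * y := by
  rcases hx.eq_or_lt with rfl | hx
  · simp [ψ.map_zero]
  have hy0 : 0 < y := hx.trans_le hxy
  have h := ψ.concaveOn.2 (show (0 : ℝ) ∈ Icc (0 : ℝ) 1 by simp)
    (show y ∈ Icc (0 : ℝ) 1 from ⟨hy0.le, hy⟩)
    (sub_nonneg.2 ((div_le_one hy0).2 hxy)) (div_nonneg hx.le hy0.le) (by ring)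
  simp only [smul_eq_mul, ψ.map_zero, mul_zero, zero_add, div_mul_cancel₀ _ hy0.ne'] at h
  calc ψ y * x = (x / y * ψ y) * y := by field_simp
    _ ≤ ψ x * y := mul_le_mul_of_nonneg_right h hy0.le

/-- `(ψ(x) - x) / x` is nonincreasing. -/
theorem sub_self_mul_le {x y : ℝ} (hx : 0 ≤ x) (hxy : x ≤ y) (hy : y ≤ 1) :
    (ψ y - y) * x ≤ (ψ x - x) * y := by
  have := ψ.apply_mul_le hx hxy hy
  linarith

/-- `(ψ(x) - x) / (1 - x)` is nondecreasing. -/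
theorem sub_self_mul_one_sub_le {x y : ℝ} (hx : 0 ≤ x) (hxy : x ≤ y) (hy : y ≤ 1) :
    (ψ x - x) * (1 - y) ≤ (ψ y - y) * (1 - x) := by
  rcases (hxy.trans hy).eq_or_lt with rfl | hx1
  · simp [ψ.map_one]
  have h1 : 0 < 1 - x := sub_pos.2 hx1
  have h := ψ.concaveOn.2 (show x ∈ Icc (0 : ℝ) 1 from ⟨hx, hx1.le⟩)
    (show (1 : ℝ) ∈ Icc (0 : ℝ) 1 by simp)
    (div_nonneg (sub_nonneg.2 hy) h1.le) (div_nonneg (sub_nonneg.2 hxy) h1.le)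
    (by field_simp; ring)
  have e : (1 - y) / (1 - x) * x + (y - x) / (1 - x) * 1 = y := by field_simp; ring
  simp only [smul_eq_mul, ψ.map_one] at h
  rw [e] at h
  have h2 := mul_le_mul_of_nonneg_right h h1.le
  have e2 : ((1 - y) / (1 - x) * ψ x + (y - x) / (1 - x) * 1) * (1 - x)
    = (1 - y) * ψ x + (y - x) := by field_simp
  rw [e2] at h2
  linarith

/-- The only idempotent concave distortions are the identity and the one that is `1` on `(0,1]`. -/
theorem eq_self_or_eq_one_of_idempotent (h : ∀ x ∈ Icc (0 : ℝ) 1, ψ (ψ x) = ψ x) :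
    (∀ x ∈ Icc (0 : ℝ) 1, ψ x = x) ∨ ∀ x ∈ Ioc (0 : ℝ) 1, ψ x = 1 := by
  by_contra! hc
  obtain ⟨⟨a, ha, hne⟩, b, hb, hb1⟩ := hc
  have hlt : a < ψ a := lt_of_le_of_ne (ψ.le_apply ha) (Ne.symm hne)
  have ha0 : 0 < a := lt_of_le_of_ne ha.1 fun e => by simp [← e, ψ.map_zero] at hlt
  have ha1 : a < 1 := lt_of_le_of_ne ha.2 fun e => by simp [e, ψ.map_one] at hlt
  -- a fixed point `ψ a < 1` would force `ψ - id` to vanish at `ψ a`, hence at `a`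
  have key : ∀ x, 0 < x → x < 1 → x < ψ x → ψ x = 1 := fun x hx0 hx1 hx => by
    have hm := ψ.mem_Icc ⟨hx0.le, hx1.le⟩
    have := ψ.sub_self_mul_one_sub_le hx0.le hx.le hm.2
    rw [h x ⟨hx0.le, hx1.le⟩, sub_self, zero_mul] at this
    by_contra hne1
    have h3 : ψ x < 1 := lt_of_le_of_ne hm.2 hne1
    nlinarith [mul_pos (sub_pos.2 hx) (sub_pos.2 h3)]
  have e1 : ψ a = 1 := key a ha0 ha1 hlt
  have hb1' : b < 1 := lt_of_le_of_ne hb.2 fun e => by simp [e, ψ.map_one] at hb1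
  have hbe : ψ b = b := by
    by_contra hne2
    exact hb1 (key b hb.1 hb1' (lt_of_le_of_ne (ψ.le_apply ⟨hb.1.le, hb.2⟩) (Ne.symm hne2)))
  rcases le_total b a with hab | hab
  · have := ψ.sub_self_mul_le hb.1.le hab ha1.le
    rw [hbe, e1] at this
    nlinarith [mul_pos (sub_pos.2 ha1) hb.1]
  · have := ψ.monotoneOn ha ⟨hb.1.le, hb.2⟩ hab
    rw [hbe, e1] at this
    linarith

end ConcaveDistortion

namespace DistortionSemigroup

variable (Ψ : DistortionSemigroup)

theorem add_apply (s t : ℝ≥0) {x : ℝ} (hx : x ∈ Icc (0 : ℝ) 1) : Ψ (s + t) x = Ψ s (Ψ t x) :=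
  (Ψ.comp_eq s t x hx).symm

theorem monotone_time {x : ℝ} (hx : x ∈ Icc (0 : ℝ) 1) : Monotone fun t : ℝ≥0 => Ψ t x := by
  intro s t hst
  obtain ⟨r, rfl⟩ := exists_add_of_le hst
  simp only
  rw [add_comm, Ψ.add_apply _ _ hx]
  exact (Ψ r).le_apply ((Ψ s).mem_Icc hx)

variable {Ψ}

theorem tendsto_sInf (Ψ : DistortionSemigroup) {x : ℝ} (hx : x ∈ Icc (0 : ℝ) 1) :
    Tendsto (fun t : ℝ≥0 => Ψ t x) (𝓝[>] 0) (𝓝 (sInf ((fun t : ℝ≥0 => Ψ t x) '' Ioi 0))) :=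
  (Ψ.monotone_time hx).tendsto_nhdsGT 0

/-- The limit `lim_{t ↓ 0} Ψ_t`, as a concave distortion. -/
noncomputable def rightLimitZero (Ψ : DistortionSemigroup) : ConcaveDistortion where
  toFun x := sInf ((fun t : ℝ≥0 => Ψ t x) '' Ioi 0)
  concaveOn := by
    refine ⟨convex_Icc 0 1, fun x hx y hy a b ha hb hab => ?_⟩
    refine le_of_tendsto_of_tendsto' (((Ψ.tendsto_sInf hx).const_smul a).add
      ((Ψ.tendsto_sInf hy).const_smul b))
      (Ψ.tendsto_sInf (convex_Icc (0 : ℝ) 1 hx hy ha hb hab)) fun t => ?_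
    exact (Ψ t).concaveOn.2 hx hy ha hb hab
  monotoneOn x hx y hy hxy := le_of_tendsto_of_tendsto' (Ψ.tendsto_sInf hx) (Ψ.tendsto_sInf hy)
    fun t => (Ψ t).monotoneOn hx hy hxy
  map_zero := tendsto_nhds_unique (Ψ.tendsto_sInf (by simp)) (by simp [(Ψ _).map_zero])
  map_one := tendsto_nhds_unique (Ψ.tendsto_sInf (by simp)) (by simp [(Ψ _).map_one])

theorem rightLimitZero_le (Ψ : DistortionSemigroup) {t : ℝ≥0} (ht : 0 < t) {x : ℝ}
    (hx : x ∈ Icc (0 : ℝ) 1) : Ψ.rightLimitZero x ≤ Ψ t x := by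
  refine le_of_tendsto (Ψ.tendsto_sInf hx) ?_
  filter_upwards [Ioo_mem_nhdsGT ht] with s hs using Ψ.monotone_time hx hs.2.le

/-- A nontrivial concave distortion semigroup is right-continuous at time `0`: the limit of `Ψ_t`
is an idempotent concave distortion. -/
theorem IsNontrivial.tendsto_apply (hΨ : Ψ.IsNontrivial) {x : ℝ} (hx : x ∈ Icc (0 : ℝ) 1) :
    Tendsto (fun t : ℝ≥0 => Ψ t x) (𝓝[>] 0) (𝓝 x) := by
  have hid : ∀ y ∈ Icc (0 : ℝ) 1, Ψ.rightLimitZero (Ψ.rightLimitZero y) = Ψ.rightLimitZero y := by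
    intro y hy
    have hm := Ψ.rightLimitZero.mem_Icc hy
    refine le_antisymm (ge_of_tendsto (Ψ.tendsto_sInf hy) ?_) (Ψ.rightLimitZero.le_apply hm)
    filter_upwards [self_mem_nhdsWithin] with t ht
    have ht2 : 0 < t / 2 := half_pos ht
    calc Ψ.rightLimitZero (Ψ.rightLimitZero y) ≤ Ψ.rightLimitZero (Ψ (t / 2) y) :=
          Ψ.rightLimitZero.monotoneOn hm ((Ψ _).mem_Icc hy) (Ψ.rightLimitZero_le ht2 hy)
      _ ≤ Ψ (t / 2) (Ψ (t / 2) y) := Ψ.rightLimitZero_le ht2 ((Ψ _).mem_Icc hy)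
      _ = Ψ t y := by rw [← Ψ.add_apply _ _ hy, add_halves]
  rcases Ψ.rightLimitZero.eq_self_or_eq_one_of_idempotent hid with h | h
  · have := Ψ.tendsto_sInf hx
    change Tendsto _ _ (𝓝 (Ψ.rightLimitZero x)) at this
    rwa [h x hx] at this
  · refine absurd (fun t ht y hy => ?_) hΨ.2
    have := Ψ.rightLimitZero_le ht ⟨hy.1.le, hy.2⟩
    rw [h y hy] at this
    exact le_antisymm ((Ψ t).le_one ⟨hy.1.le, hy.2⟩) this

theorem IsNontrivial.zero_apply (hΨ : Ψ.IsNontrivial) {x : ℝ} (hx : x ∈ Icc (0 : ℝ) 1) :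
    Ψ 0 x = x := by
  refine le_antisymm (ge_of_tendsto (hΨ.tendsto_apply hx) (.of_forall fun t => ?_))
    ((Ψ 0).le_apply hx)
  exact Ψ.monotone_time hx zero_le

/-- At positive times, a nontrivial semigroup lies strictly above the identity on `(0,1)`. -/
theorem IsNontrivial.lt_apply (hΨ : Ψ.IsNontrivial) {t : ℝ≥0} (ht : 0 < t) {x : ℝ}
    (hx : x ∈ Ioo (0 : ℝ) 1) : x < Ψ t x := by
  have hx' : x ∈ Icc (0 : ℝ) 1 := Ioo_subset_Icc_self hx
  refine lt_of_le_of_ne ((Ψ t).le_apply hx') fun he => hΨ.1 ?_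
  -- a concave distortion with an interior fixed point is the identity
  have hid : ∀ y ∈ Icc (0 : ℝ) 1, Ψ t y = y := fun y hy => by
    refine le_antisymm ?_ ((Ψ t).le_apply hy)
    rcases le_total x y with h | h
    · have := (Ψ t).sub_self_mul_le hx.1.le h hy.2
      rw [← he, sub_self, zero_mul] at this
      nlinarith [hx.1]
    · have := (Ψ t).sub_self_mul_one_sub_le hy.1 h hx.2.le
      rw [← he, sub_self, zero_mul] at this
      nlinarith [hx.2]
  have hn : ∀ n : ℕ, ∀ y ∈ Icc (0 : ℝ) 1, Ψ (n * t) y = y := fun n => by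
    induction n with
    | zero => intro y hy; simpa using hΨ.zero_apply hy
    | succ n ih =>
      intro y hy
      rw [Nat.cast_succ, add_mul, one_mul, Ψ.add_apply _ _ hy, hid y hy, ih y hy]
  intro s y hy
  obtain ⟨n, hn'⟩ := exists_nat_ge (s / t)
  refine le_antisymm ?_ ((Ψ s).le_apply hy)
  have := Ψ.monotone_time hy ((div_le_iff₀ ht).1 hn')
  simpa [hn n y hy] using this

/-- Difference-quotient estimate from above: along the trajectory of `x` the increments per step `t`
are at most proportional to the position, as `(Ψ_t(y) - y) / y` is nonincreasing. -/
theorem iterate_sub_le (hΨ : Ψ.IsNontrivial) (t : ℝ≥0) {x M : ℝ} (hx : x ∈ Ioo (0 : ℝ) 1) (n : ℕ)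
    (hM : Ψ (n * t) x ≤ M) : (Ψ (n * t) x - x) * x ≤ n * (Ψ t x - x) * M := by
  have hx' : x ∈ Icc (0 : ℝ) 1 := Ioo_subset_Icc_self hx
  induction n with
  | zero => simp [hΨ.zero_apply hx']
  | succ n ih =>
    have hle : Ψ (n * t) x ≤ Ψ ((n + 1 : ℕ) * t) x := Ψ.monotone_time hx' (by gcongr; simp)
    have hm := (Ψ (n * t)).mem_Icc hx'
    have h1 := ih (hle.trans hM)
    have h2 := (Ψ t).sub_self_mul_le hx.1.le ((Ψ (n * t)).le_apply hx') hm.2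
    have h3 : (Ψ t x - x) * Ψ (n * t) x ≤ (Ψ t x - x) * M :=
      mul_le_mul_of_nonneg_left (hle.trans hM) (sub_nonneg.2 ((Ψ t).le_apply hx'))
    have e : Ψ ((n + 1 : ℕ) * t) x = Ψ t (Ψ (n * t) x) := by
      rw [← Ψ.add_apply _ _ hx']; congr 2; push_cast; ring
    rw [e]
    push_cast
    linarith

/-- Difference-quotient estimate from below, as `(Ψ_t(y) - y) / (1 - y)` is nondecreasing. -/
theorem le_iterate_sub (hΨ : Ψ.IsNontrivial) (t : ℝ≥0) {x M : ℝ} (hx : x ∈ Ioo (0 : ℝ) 1) (n : ℕ)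
    (hM : Ψ (n * t) x ≤ M) : n * (Ψ t x - x) * (1 - M) ≤ (Ψ (n * t) x - x) * (1 - x) := by
  have hx' : x ∈ Icc (0 : ℝ) 1 := Ioo_subset_Icc_self hx
  induction n with
  | zero => simp [hΨ.zero_apply hx']
  | succ n ih =>
    have hle : Ψ (n * t) x ≤ Ψ ((n + 1 : ℕ) * t) x := Ψ.monotone_time hx' (by gcongr; simp)
    have hm := (Ψ (n * t)).mem_Icc hx'
    have h1 := ih (hle.trans hM)
    have h2 := (Ψ t).sub_self_mul_one_sub_le hx.1.le ((Ψ (n * t)).le_apply hx') hm.2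
    have h3 : (Ψ t x - x) * (1 - M) ≤ (Ψ t x - x) * (1 - Ψ (n * t) x) :=
      mul_le_mul_of_nonneg_left (by linarith [hle.trans hM])
        (sub_nonneg.2 ((Ψ t).le_apply hx'))
    have e : Ψ ((n + 1 : ℕ) * t) x = Ψ t (Ψ (n * t) x) := by
      rw [← Ψ.add_apply _ _ hx']; congr 2; push_cast; ring
    rw [e]
    push_cast
    linarith

/-- Comparison of the difference quotients at times `t ≤ s`, from above. -/
theorem quotient_le (hΨ : Ψ.IsNontrivial) {s t : ℝ≥0} (ht : 0 < t) (hts : t ≤ s) {x : ℝ}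
    (hx : x ∈ Ioo (0 : ℝ) 1) :
    (Ψ s x - x) / s * x / Ψ (2 * s) x ≤ (1 + t / s) * ((Ψ t x - x) / t) := by
  have hx' : x ∈ Icc (0 : ℝ) 1 := Ioo_subset_Icc_self hx
  have hs : 0 < s := ht.trans_le hts
  have ht' : (0 : ℝ) < t := ht
  have hs' : (0 : ℝ) < s := hs
  set n := ⌈s / t⌉₊
  have hn1 : s ≤ n * t := (div_le_iff₀ ht).1 (Nat.le_ceil _)
  have hn2 : n * t ≤ s + t := by
    have := (Nat.ceil_lt_add_one (a := s / t) zero_le).le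
    calc (n : ℝ≥0) * t ≤ (s / t + 1) * t := by gcongr
      _ = s + t := by rw [add_mul, div_mul_cancel₀ _ ht.ne', one_mul]
  have hM : Ψ (n * t) x ≤ Ψ (2 * s) x := Ψ.monotone_time hx' (hn2.trans (by rw [two_mul]; gcongr))
  have h1 := iterate_sub_le hΨ t hx n hM
  have h0 : 0 < Ψ (2 * s) x := hx.1.trans_le ((Ψ _).le_apply hx')
  have h2 : (Ψ s x - x) * x ≤ (Ψ (n * t) x - x) * x :=
    mul_le_mul_of_nonneg_right (sub_le_sub_right (Ψ.monotone_time hx' hn1) _) hx.1.le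
  have hn3 : (n : ℝ) * t ≤ s + t := by exact_mod_cast hn2
  have h4 : 0 ≤ (Ψ t x - x) * Ψ (2 * s) x / t :=
    div_nonneg (mul_nonneg (sub_nonneg.2 ((Ψ t).le_apply hx')) h0.le) ht'.le
  rw [div_le_iff₀ h0, div_mul_eq_mul_div, div_le_iff₀ hs']
  calc (Ψ s x - x) * x ≤ n * (Ψ t x - x) * Ψ (2 * s) x := h2.trans h1
    _ = (n * t) * ((Ψ t x - x) * Ψ (2 * s) x / t) := by field_simp
    _ ≤ (s + t) * ((Ψ t x - x) * Ψ (2 * s) x / t) := mul_le_mul_of_nonneg_right hn3 h4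
    _ = (1 + t / s) * ((Ψ t x - x) / t) * Ψ (2 * s) x * s := by field_simp

/-- Comparison of the difference quotients at times `t ≤ s`, from below. -/
theorem le_quotient (hΨ : Ψ.IsNontrivial) {s t : ℝ≥0} (ht : 0 < t) (hts : t ≤ s) {x : ℝ}
    (hx : x ∈ Ioo (0 : ℝ) 1) :
    (1 - t / s) * ((Ψ t x - x) / t) * (1 - Ψ s x) ≤ (Ψ s x - x) / s * (1 - x) := by
  have hx' : x ∈ Icc (0 : ℝ) 1 := Ioo_subset_Icc_self hx
  have hs : 0 < s := ht.trans_le hts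
  have ht' : (0 : ℝ) < t := ht
  have hs' : (0 : ℝ) < s := hs
  set n := ⌊s / t⌋₊
  have hn1 : n * t ≤ s := (le_div_iff₀ ht).1 (Nat.floor_le zero_le)
  have hn2 : (s : ℝ) - t ≤ n * t := by
    have : s ≤ (n + 1) * t := (div_le_iff₀ ht).1 (Nat.lt_floor_add_one (s / t)).le
    have h2 : (s : ℝ) ≤ (n + 1) * t := by exact_mod_cast this
    linarith
  have hM : Ψ (n * t) x ≤ Ψ s x := Ψ.monotone_time hx' hn1
  have h1 := le_iterate_sub hΨ t hx n hM
  have h2 : (Ψ (n * t) x - x) * (1 - x) ≤ (Ψ s x - x) * (1 - x) :=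
    mul_le_mul_of_nonneg_right (sub_le_sub_right hM _) (sub_nonneg.2 hx.2.le)
  have h4 : 0 ≤ (Ψ t x - x) * (1 - Ψ s x) / t :=
    div_nonneg (mul_nonneg (sub_nonneg.2 ((Ψ t).le_apply hx'))
      (sub_nonneg.2 ((Ψ s).le_one hx'))) ht'.le
  rw [div_mul_eq_mul_div, le_div_iff₀ hs']
  calc (1 - t / s) * ((Ψ t x - x) / t) * (1 - Ψ s x) * s
      = (s - t) * ((Ψ t x - x) * (1 - Ψ s x) / t) := by field_simp
    _ ≤ (n * t) * ((Ψ t x - x) * (1 - Ψ s x) / t) := mul_le_mul_of_nonneg_right hn2 h4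
    _ = n * (Ψ t x - x) * (1 - Ψ s x) := by field_simp
    _ ≤ _ := h1.trans h2

theorem tendsto_coe_zero : Tendsto (fun t : ℝ≥0 => (t : ℝ)) (𝓝[>] 0) (𝓝 0) :=
  (NNReal.continuous_coe.tendsto 0).mono_left nhdsWithin_le_nhds

/-- The generator exists and is positive: the comparison of difference quotients squeezes
`(Ψ_s(x) - x) / s` between `L (1 - Ψ_s(x)) / (1 - x)` and `L Ψ_{2s}(x) / x`, where `L` is the supremum
of `(Ψ_s(x) - x) / s * x / Ψ_{2s}(x)` over `s > 0`. -/
theorem IsNontrivial.exists_tendsto (hΨ : Ψ.IsNontrivial) {x : ℝ} (hx : x ∈ Ioo (0 : ℝ) 1) :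
    ∃ L : ℝ, 0 < L ∧ Tendsto (fun t : ℝ≥0 => (Ψ t x - x) / (t : ℝ)) (𝓝[>] 0) (𝓝 L) := by
  have hx' : x ∈ Icc (0 : ℝ) 1 := Ioo_subset_Icc_self hx
  set a : ℝ≥0 → ℝ := fun s => (Ψ s x - x) / s * x / Ψ (2 * s) x
  have hpos : ∀ s, 0 < Ψ s x := fun s => hx.1.trans_le ((Ψ _).le_apply hx')
  have hab : ∀ s r : ℝ≥0, 0 < s → 0 < r → a s * (1 - Ψ r x) ≤ (Ψ r x - x) / r * (1 - x) := by
    intro s r hs hr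
    have l1 : Tendsto (fun t : ℝ≥0 => (1 - (t : ℝ) / r) * (a s * (1 - Ψ r x))) (𝓝[>] 0)
        (𝓝 ((1 - 0 / (r : ℝ)) * (a s * (1 - Ψ r x)))) :=
      (tendsto_const_nhds.sub (tendsto_coe_zero.div_const _)).mul_const _
    have l2 : Tendsto (fun t : ℝ≥0 => (1 + (t : ℝ) / s) * ((Ψ r x - x) / r * (1 - x))) (𝓝[>] 0)
        (𝓝 ((1 + 0 / (s : ℝ)) * ((Ψ r x - x) / r * (1 - x)))) :=
      (tendsto_const_nhds.add (tendsto_coe_zero.div_const _)).mul_const _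
    simp only [zero_div, sub_zero, add_zero, one_mul] at l1 l2
    refine le_of_tendsto_of_tendsto l1 l2 ?_
    filter_upwards [Ioo_mem_nhdsGT (lt_min hs hr)] with t ht
    have hts : t ≤ s := ht.2.le.trans (min_le_left _ _)
    have htr : t ≤ r := ht.2.le.trans (min_le_right _ _)
    have h1 := quotient_le hΨ ht.1 hts hx
    have h2 := le_quotient hΨ ht.1 htr hx
    have h3 : 0 ≤ 1 - (t : ℝ) / r := sub_nonneg.2 (div_le_one_of_le₀ (by exact_mod_cast htr) r.2)
    have h4 : 0 ≤ 1 - Ψ r x := sub_nonneg.2 ((Ψ r).le_one hx')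
    have h5 : 0 ≤ 1 + (t : ℝ) / s := by positivity
    calc (1 - (t : ℝ) / r) * (a s * (1 - Ψ r x))
        ≤ (1 - (t : ℝ) / r) * ((1 + t / s) * ((Ψ t x - x) / t) * (1 - Ψ r x)) := by gcongr
      _ = (1 + t / s) * ((1 - t / r) * ((Ψ t x - x) / t) * (1 - Ψ r x)) := by ring
      _ ≤ _ := by gcongr
  obtain ⟨r, hr0, hr1⟩ : ∃ r : ℝ≥0, 0 < r ∧ Ψ r x < 1 := by
    have := ((hΨ.tendsto_apply hx').eventually (gt_mem_nhds hx.2)).and self_mem_nhdsWithin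
    obtain ⟨r, h1, h2⟩ := this.exists
    exact ⟨r, h2, h1⟩
  have hbdd : BddAbove (a '' Ioi 0) := by
    refine ⟨(Ψ r x - x) / r * (1 - x) / (1 - Ψ r x), ?_⟩
    rintro _ ⟨s, hs, rfl⟩
    rw [le_div_iff₀ (sub_pos.2 hr1)]
    exact hab s r hs hr0
  have hne : (a '' Ioi 0).Nonempty := ⟨_, r, hr0, rfl⟩
  set L := sSup (a '' Ioi 0)
  have haL : ∀ s, 0 < s → a s ≤ L := fun s hs => le_csSup hbdd ⟨s, hs, rfl⟩
  have hLb : ∀ s : ℝ≥0, 0 < s → L * (1 - Ψ s x) ≤ (Ψ s x - x) / s * (1 - x) := by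
    intro s hs
    rcases ((Ψ s).le_one hx').eq_or_lt with h1 | h1
    · rw [h1, sub_self, mul_zero]
      have := hx.2
      exact mul_nonneg (div_nonneg (by linarith) s.2) (by linarith)
    · rw [← le_div_iff₀ (sub_pos.2 h1)]
      refine csSup_le hne ?_
      rintro _ ⟨q, hq, rfl⟩
      rw [le_div_iff₀ (sub_pos.2 h1)]
      exact hab q s hq hs
  have hL : 0 < L := lt_of_lt_of_le (div_pos (mul_pos (div_pos (sub_pos.2 (hΨ.lt_apply hr0 hx))
    hr0) hx.1) (hpos _)) (haL r hr0)
  refine ⟨L, hL, ?_⟩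
  have h2 : Tendsto (fun t : ℝ≥0 => 2 * t) (𝓝[>] 0) (𝓝[>] 0) := by
    refine tendsto_nhdsWithin_iff.2 ⟨?_, ?_⟩
    · have : Tendsto (fun t : ℝ≥0 => 2 * t) (𝓝 0) (𝓝 (2 * 0)) :=
        (by fun_prop : Continuous fun t : ℝ≥0 => 2 * t).tendsto 0
      rw [mul_zero] at this
      exact this.mono_left nhdsWithin_le_nhds
    · filter_upwards [self_mem_nhdsWithin] with t ht
      exact mul_pos two_pos (mem_Ioi.1 ht)
  have l1 : Tendsto (fun t : ℝ≥0 => L * (1 - Ψ t x) / (1 - x)) (𝓝[>] 0)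
      (𝓝 (L * (1 - x) / (1 - x))) :=
    ((tendsto_const_nhds.sub (hΨ.tendsto_apply hx')).const_mul L).div_const _
  have l2 : Tendsto (fun t : ℝ≥0 => L * Ψ (2 * t) x / x) (𝓝[>] 0) (𝓝 (L * x / x)) :=
    (((hΨ.tendsto_apply hx').comp h2).const_mul L).div_const _
  rw [mul_div_cancel_right₀ _ (sub_pos.2 hx.2).ne'] at l1
  rw [mul_div_cancel_right₀ _ hx.1.ne'] at l2
  refine tendsto_of_tendsto_of_tendsto_of_le_of_le' l1 l2 ?_ ?_
  · filter_upwards [self_mem_nhdsWithin] with t ht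
    rw [div_le_iff₀ (sub_pos.2 hx.2)]
    exact hLb t ht
  · filter_upwards [self_mem_nhdsWithin] with t ht
    rw [le_div_iff₀ hx.1]
    exact (div_le_iff₀ (hpos _)).1 (haL t ht)

theorem IsNontrivial.tendsto_generator (hΨ : Ψ.IsNontrivial) {x : ℝ} (hx : x ∈ Ioo (0 : ℝ) 1) :
    Tendsto (fun t : ℝ≥0 => (Ψ t x - x) / (t : ℝ)) (𝓝[>] 0) (𝓝 (Ψ.generator x)) := by
  obtain ⟨L, -, hL⟩ := hΨ.exists_tendsto hx
  rw [generator, if_pos hx, hL.limUnder_eq]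
  exact hL

theorem IsNontrivial.generator_pos (hΨ : Ψ.IsNontrivial) {x : ℝ} (hx : x ∈ Ioo (0 : ℝ) 1) :
    0 < Ψ.generator x := by
  obtain ⟨L, h0, hL⟩ := hΨ.exists_tendsto hx
  rw [generator, if_pos hx, hL.limUnder_eq]
  exact h0

end DistortionSemigroup

/-! ### Travel times of trajectories -/

/-- A concave distortion that does not tend to `0` at `0` is bounded away from `0` on `(0,1]`. -/
theorem ConcaveDistortion.exists_pos_le_of_not_tendsto (ψ : ConcaveDistortion)
    (h : ¬ Tendsto ψ (𝓝[>] 0) (𝓝 0)) : ∃ c : ℝ, 0 < c ∧ ∀ x ∈ Ioc (0 : ℝ) 1, c ≤ ψ x := by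
  by_contra! hc
  refine h (tendsto_order.2 ⟨fun a ha => ?_, fun a ha => ?_⟩)
  · filter_upwards [Ioc_mem_nhdsGT one_pos] with x hx
    exact ha.trans_le (ψ.nonneg (Ioc_subset_Icc_self hx))
  · obtain ⟨x, hx, hxa⟩ := hc a ha
    filter_upwards [Ioo_mem_nhdsGT hx.1] with z hz
    exact (ψ.monotoneOn ⟨hz.1.le, hz.2.le.trans hx.2⟩ ⟨hx.1.le, hx.2⟩ hz.2.le).trans_lt hxa

namespace DistortionSemigroup

variable {Ψ : DistortionSemigroup}

theorem IsNontrivial.concaveOn_generator (hΨ : Ψ.IsNontrivial) :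
    ConcaveOn ℝ (Ioo 0 1) Ψ.generator := by
  refine ⟨convex_Ioo 0 1, fun x hx y hy a b ha hb hab => ?_⟩
  refine le_of_tendsto_of_tendsto' (((hΨ.tendsto_generator hx).const_smul a).add
    ((hΨ.tendsto_generator hy).const_smul b))
    (hΨ.tendsto_generator (convex_Ioo (0 : ℝ) 1 hx hy ha hb hab)) fun t => ?_
  have := (Ψ t).concaveOn.2 (Ioo_subset_Icc_self hx) (Ioo_subset_Icc_self hy) ha hb hab
  simp only [smul_eq_mul] at this ⊢
  calc a * ((Ψ t x - x) / t) + b * ((Ψ t y - y) / t)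
      = (a * Ψ t x + b * Ψ t y - (a * x + b * y)) / t := by ring
    _ ≤ _ := by gcongr

theorem IsNontrivial.continuousOn_generator (hΨ : Ψ.IsNontrivial) :
    ContinuousOn Ψ.generator (Ioo 0 1) :=
  hΨ.concaveOn_generator.continuousOn isOpen_Ioo

theorem IsNontrivial.continuousOn_one_div_generator (hΨ : Ψ.IsNontrivial) :
    ContinuousOn (fun s => 1 / Ψ.generator s) (Ioo 0 1) :=
  continuousOn_const.div hΨ.continuousOn_generator fun _ hx => (hΨ.generator_pos hx).ne'

theorem tendsto_toNNReal_sub (t : ℝ) :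
    Tendsto (fun z : ℝ => (z - t).toNNReal) (𝓝[>] t) (𝓝[>] 0) := by
  refine tendsto_nhdsWithin_iff.2 ⟨?_, ?_⟩
  · have : Tendsto (fun z : ℝ => (z - t).toNNReal) (𝓝 t) (𝓝 (t - t).toNNReal) :=
      (by fun_prop : Continuous fun z : ℝ => (z - t).toNNReal).tendsto t
    rw [sub_self, Real.toNNReal_zero] at this
    exact this.mono_left nhdsWithin_le_nhds
  · filter_upwards [self_mem_nhdsWithin] with z hz
    exact Real.toNNReal_pos.2 (sub_pos.2 hz)

theorem toNNReal_apply_add {t z : ℝ} (ht : 0 ≤ t) (hz : t ≤ z) {x : ℝ} (hx : x ∈ Icc (0 : ℝ) 1) :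
    Ψ z.toNNReal x = Ψ (z - t).toNNReal (Ψ t.toNNReal x) := by
  rw [← Ψ.add_apply _ _ hx, ← Real.toNNReal_add (sub_nonneg.2 hz) ht, sub_add_cancel]

/-- Trajectories move continuously in time; the modulus is uniform along a trajectory, as
`Ψ_h(y) - y ≤ (Ψ_h(x) - x) / x` for `y ≥ x`. -/
theorem IsNontrivial.continuousOn_time (hΨ : Ψ.IsNontrivial) {x : ℝ} (hx : x ∈ Ioc (0 : ℝ) 1) :
    ContinuousOn (fun t : ℝ => Ψ t.toNNReal x) (Ici 0) := by
  have hx' : x ∈ Icc (0 : ℝ) 1 := Ioc_subset_Icc_self hx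
  have key : ∀ s t : ℝ, 0 ≤ s → s ≤ t →
      Ψ t.toNNReal x - Ψ s.toNNReal x ≤ (Ψ (t - s).toNNReal x - x) / x := by
    intro s t hs hst
    have hm := (Ψ s.toNNReal).mem_Icc hx'
    rw [toNNReal_apply_add hs hst hx', le_div_iff₀ hx.1]
    refine ((Ψ _).sub_self_mul_le hx.1.le ((Ψ _).le_apply hx') hm.2).trans ?_
    exact mul_le_of_le_one_right (sub_nonneg.2 ((Ψ _).le_apply hx')) hm.2
  have lim : Tendsto (fun r : ℝ => (Ψ r.toNNReal x - x) / x) (𝓝[≥] 0) (𝓝 0) := by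
    have h1 : Tendsto (fun r : ℝ => (Ψ r.toNNReal x - x) / x) (𝓝[>] 0) (𝓝 0) := by
      have := (((hΨ.tendsto_apply hx').comp (tendsto_toNNReal_sub 0)).sub_const x).div_const x
      simpa [Function.comp_def] using this
    rw [← Ioi_insert, nhdsWithin_insert]
    refine Tendsto.sup ?_ h1
    rw [tendsto_pure_left]
    intro s hs
    simpa [hΨ.zero_apply hx'] using mem_of_mem_nhds hs
  intro t ht
  have habs : Tendsto (fun z : ℝ => |z - t|) (𝓝[Ici 0] t) (𝓝[≥] 0) := by
    refine tendsto_nhdsWithin_iff.2 ⟨?_, .of_forall fun z => mem_Ici.2 (abs_nonneg _)⟩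
    have : Tendsto (fun z : ℝ => |z - t|) (𝓝 t) (𝓝 |t - t|) :=
      (by fun_prop : Continuous fun z : ℝ => |z - t|).tendsto t
    rw [sub_self, abs_zero] at this
    exact this.mono_left nhdsWithin_le_nhds
  refine tendsto_iff_dist_tendsto_zero.2 (squeeze_zero' (.of_forall fun _ => dist_nonneg) ?_
    (lim.comp habs))
  filter_upwards [self_mem_nhdsWithin] with z hz
  have mono : Monotone fun t : ℝ => Ψ t.toNNReal x :=
    fun a b h => Ψ.monotone_time hx' (Real.toNNReal_mono h)
  rw [Real.dist_eq, Function.comp]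
  rcases le_total z t with h | h
  · rw [abs_sub_comm, abs_of_nonneg (sub_nonneg.2 (mono h)), abs_sub_comm z t,
      abs_of_nonneg (sub_nonneg.2 h)]
    exact key z t hz h
  · rw [abs_of_nonneg (sub_nonneg.2 (mono h)), abs_of_nonneg (sub_nonneg.2 h)]
    exact key t z ht h

theorem IsNontrivial.hasDerivWithinAt_time (hΨ : Ψ.IsNontrivial) {x t : ℝ} (hx : x ∈ Ioo (0 : ℝ) 1)
    (ht : 0 ≤ t) (h1 : Ψ t.toNNReal x < 1) :
    HasDerivWithinAt (fun t : ℝ => Ψ t.toNNReal x) (Ψ.generator (Ψ t.toNNReal x)) (Ici t) t := by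
  have hx' : x ∈ Icc (0 : ℝ) 1 := Ioo_subset_Icc_self hx
  have hu : Ψ t.toNNReal x ∈ Ioo (0 : ℝ) 1 := ⟨hx.1.trans_le ((Ψ _).le_apply hx'), h1⟩
  rw [← hasDerivWithinAt_Ioi_iff_Ici, hasDerivWithinAt_iff_tendsto_slope' self_notMem_Ioi]
  refine ((hΨ.tendsto_generator hu).comp (tendsto_toNNReal_sub t)).congr' ?_
  filter_upwards [self_mem_nhdsWithin] with z hz
  have hz : t < z := hz
  rw [slope_def_field, toNNReal_apply_add ht hz.le hx', Function.comp,
    Real.coe_toNNReal _ (sub_nonneg.2 hz.le)]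

/-- The time that a trajectory needs to travel from `x` to `Ψ_T(x)` is the integral of `1 / G`. -/
theorem IsNontrivial.integral_one_div_generator (hΨ : Ψ.IsNontrivial) {x : ℝ}
    (hx : x ∈ Ioo (0 : ℝ) 1) (T : ℝ≥0) (h1 : Ψ T x < 1) :
    ∫ s in x..Ψ T x, 1 / Ψ.generator s = T := by
  have hx' : x ∈ Icc (0 : ℝ) 1 := Ioo_subset_Icc_self hx
  have hcont := hΨ.continuousOn_one_div_generator
  have hmem : ∀ t ∈ Icc (0 : ℝ) T, Ψ t.toNNReal x ∈ Ioo (0 : ℝ) 1 := fun t ht =>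
    ⟨hx.1.trans_le ((Ψ _).le_apply hx'),
      (Ψ.monotone_time hx' (Real.toNNReal_le_iff_le_coe.2 ht.2)).trans_lt h1⟩
  have hL : ∀ y ∈ Ioo (0 : ℝ) 1,
      HasDerivAt (fun u => ∫ s in x..u, 1 / Ψ.generator s) (1 / Ψ.generator y) y := by
    intro y hy
    refine intervalIntegral.integral_hasDerivAt_right ?_ ?_ ?_
    · exact (hcont.mono fun z hz => ordConnected_Ioo.uIcc_subset hx hy hz).intervalIntegrable
    · exact hcont.stronglyMeasurableAtFilter isOpen_Ioo y hy
    · exact hcont.continuousAt (isOpen_Ioo.mem_nhds hy)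
  have hcT := (hΨ.continuousOn_time ⟨hx.1, hx.2.le⟩).mono fun z (hz : z ∈ Icc (0 : ℝ) T) => hz.1
  have := constant_of_has_deriv_right_zero
    (f := fun t : ℝ => (∫ s in x..Ψ t.toNNReal x, 1 / Ψ.generator s) - t) (a := 0) (b := T) ?_ ?_
    T ⟨T.2, le_rfl⟩
  · simp only [Real.toNNReal_coe, Real.toNNReal_zero, hΨ.zero_apply hx',
      intervalIntegral.integral_same, sub_zero] at this
    linarith
  · refine ContinuousOn.sub ?_ continuousOn_id
    exact ContinuousOn.comp (g := fun u => ∫ s in x..u, 1 / Ψ.generator s) (t := Ioo 0 1)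
      (fun y hy => (hL y hy).continuousAt.continuousWithinAt) hcT hmem
  · -- the right derivative is `G(u)⁻¹ * G(u) - 1 = 0` at `u = Ψ_t(x)`
    intro t ht
    have hu := hmem t (Ico_subset_Icc_self ht)
    have h := ((hL _ hu).comp_hasDerivWithinAt t
      (hΨ.hasDerivWithinAt_time hx ht.1 hu.2)).sub (hasDerivWithinAt_id t (Ici t))
    rw [one_div_mul_cancel (hΨ.generator_pos hu).ne', sub_self] at h
    exact h

theorem IsNontrivial.ofReal_integral (hΨ : Ψ.IsNontrivial) {x y : ℝ} (hx : 0 < x) (hxy : x ≤ y)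
    (hy : y < 1) : ENNReal.ofReal (∫ s in x..y, 1 / Ψ.generator s) =
      ∫⁻ s in Ioc x y, ENNReal.ofReal (1 / Ψ.generator s) := by
  have hsub : Icc x y ⊆ Ioo (0 : ℝ) 1 := fun z hz => ⟨hx.trans_le hz.1, hz.2.trans_lt hy⟩
  rw [intervalIntegral.integral_of_le hxy, ofReal_integral_eq_lintegral_ofReal]
  · exact ((hΨ.continuousOn_one_div_generator.mono hsub).integrableOn_compact isCompact_Icc
      ).mono_set Ioc_subset_Icc_self
  · refine (ae_restrict_iff' measurableSet_Ioc).2 (.of_forall fun z hz => ?_)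
    exact one_div_nonneg.2 (hΨ.generator_pos (hsub (Ioc_subset_Icc_self hz))).le

/-- If all `Ψ_t` are continuous at `0`, trajectories can stay near `0` for arbitrarily long, so
that the time needed to leave `0` is infinite. -/
theorem IsNontrivial.lintegral_eq_top (hΨ : Ψ.IsNontrivial)
    (hc : ∀ t : ℝ≥0, Tendsto (Ψ t) (𝓝[>] 0) (𝓝 0)) {ε : ℝ} (hε : ε ∈ Ioo (0 : ℝ) 1) :
    ∫⁻ s in Ioo (0 : ℝ) ε, ENNReal.ofReal (1 / Ψ.generator s) = ∞ := by
  refine ENNReal.eq_top_of_forall_nnreal_le fun T => ?_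
  obtain ⟨x, hxε, hx⟩ := (((hc T).eventually (gt_mem_nhds hε.1)).and
    (Ioo_mem_nhdsGT hε.1)).exists
  have hx1 : x ∈ Ioo (0 : ℝ) 1 := ⟨hx.1, hx.2.trans hε.2⟩
  have h := hΨ.integral_one_div_generator hx1 T (hxε.trans hε.2)
  calc (T : ℝ≥0∞) = ENNReal.ofReal (∫ s in x..Ψ T x, 1 / Ψ.generator s) := by
        rw [h, ENNReal.ofReal_coe_nnreal]
    _ = ∫⁻ s in Ioc x (Ψ T x), ENNReal.ofReal (1 / Ψ.generator s) :=
      hΨ.ofReal_integral hx.1 ((Ψ T).le_apply (Ioo_subset_Icc_self hx1)) (hxε.trans hε.2)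
    _ ≤ _ := lintegral_mono_set
      (show Ioc x (Ψ T x) ⊆ Ioo 0 ε from fun z hz => ⟨hx.1.trans hz.1, hz.2.trans_lt hxε⟩)

/-- If `Ψ_t` jumps at `0`, then every trajectory that starts close to `0` reaches a fixed level
within the time `t`, which bounds the travel time from `0` to that level. -/
theorem IsNontrivial.tendsto_zero (hΨ : Ψ.IsNontrivial) {ε : ℝ} (hε : ε ∈ Ioo (0 : ℝ) 1)
    (hd : ∫⁻ s in Ioo (0 : ℝ) ε, ENNReal.ofReal (1 / Ψ.generator s) = ∞) (t : ℝ≥0) :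
    Tendsto (Ψ t) (𝓝[>] 0) (𝓝 0) := by
  by_contra hne
  obtain ⟨c, hc0, hc⟩ := (Ψ t).exists_pos_le_of_not_tendsto hne
  obtain ⟨y, hy0, hy⟩ : ∃ y, 0 < y ∧ y < min c ε := exists_between (lt_min hc0 hε.1)
  have hyc : y < c := hy.trans_le (min_le_left _ _)
  have hyε : y < ε := hy.trans_le (min_le_right _ _)
  have hbound : ∀ x ∈ Ioo (0 : ℝ) y,
      ∫⁻ s in Ioc x y, ENNReal.ofReal (1 / Ψ.generator s) ≤ t := by
    intro x hx
    have hx1 : x ∈ Ioo (0 : ℝ) 1 := ⟨hx.1, hx.2.trans (hyε.trans hε.2)⟩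
    have hcont := (hΨ.continuousOn_time ⟨hx1.1, hx1.2.le⟩).mono
      fun z (hz : z ∈ Icc (0 : ℝ) t) => hz.1
    obtain ⟨s, hs, hsy⟩ := intermediate_value_Icc t.2 hcont (show y ∈ _ by
      refine ⟨?_, ?_⟩
      · simpa [hΨ.zero_apply (Ioo_subset_Icc_self hx1)] using hx.2.le
      · simpa using (hyc.trans_le (hc x ⟨hx1.1, hx1.2.le⟩)).le)
    simp only at hsy
    have h := hΨ.integral_one_div_generator hx1 s.toNNReal (by rw [hsy]; exact hyε.trans hε.2)
    rw [hsy] at h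
    rw [← hΨ.ofReal_integral hx.1 hx.2.le (hyε.trans hε.2), h, ENNReal.ofReal_coe_nnreal]
    exact_mod_cast Real.toNNReal_le_iff_le_coe.2 hs.2
  have hlow : ∫⁻ s in Ioc 0 y, ENNReal.ofReal (1 / Ψ.generator s) ≤ t := by
    have hU : Ioc 0 y = ⋃ n : ℕ, Ioc (y / (n + 2)) y := by
      ext z
      simp only [mem_Ioc, mem_iUnion]
      constructor
      · rintro ⟨h0, h1⟩
        obtain ⟨n, hn⟩ := exists_nat_gt (y / z)
        refine ⟨n, ?_, h1⟩
        rw [div_lt_iff₀ (by positivity)]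
        rw [div_lt_iff₀ h0] at hn
        nlinarith
      · rintro ⟨n, h0, h1⟩
        exact ⟨lt_trans (by positivity) h0, h1⟩
    have hmono : Monotone fun n : ℕ => Ioc (y / ((n : ℝ) + 2)) y := fun m n hmn =>
      Ioc_subset_Ioc_left (by gcongr)
    rw [hU, setLIntegral_iUnion_of_directed _ hmono.directed_le]
    refine iSup_le fun n => hbound _ ⟨by positivity, ?_⟩
    rw [div_lt_iff₀ (by positivity)]
    have : (0 : ℝ) ≤ n := n.cast_nonneg
    nlinarith
  have hsub : Ioo 0 ε ⊆ Ioc 0 y ∪ Ioc y ε := fun z hz => by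
    rcases le_or_gt z y with h | h
    · exact .inl ⟨hz.1, h⟩
    · exact .inr ⟨h, hz.2.le⟩
  have := (lintegral_mono_set (μ := volume)
    (f := fun s => ENNReal.ofReal (1 / Ψ.generator s)) hsub).trans (lintegral_union_le _ _ _)
  rw [hd, ← hΨ.ofReal_integral hy0 hyε.le hε.2, top_le_iff, ENNReal.add_eq_top] at this
  rcases this with h | h
  · exact (h ▸ hlow).not_gt ENNReal.coe_lt_top
  · exact ENNReal.ofReal_ne_top h

end DistortionSemigroup

/-! ### Determining sets and distorted laws -/

namespace ConcaveDistortion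

variable (ψ : ConcaveDistortion)

/-- A concave distortion has a nonnegative supergradient at each interior point. -/
theorem exists_supergradient {p : ℝ} (hp : p ∈ Ioo (0 : ℝ) 1) :
    ∃ x : ℝ, 0 ≤ x ∧ ∀ y ∈ Icc (0 : ℝ) 1, ψ y - x * y ≤ ψ p - x * p := by
  have hp' : p ∈ Icc (0 : ℝ) 1 := Ioo_subset_Icc_self hp
  set S := (fun b => (ψ b - ψ p) / (b - p)) '' Ioc p 1
  have hS : ∀ a ∈ Ico (0 : ℝ) p, ∀ s ∈ S, s ≤ (ψ p - ψ a) / (p - a) := by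
    rintro a ha _ ⟨b, hb, rfl⟩
    exact ψ.concaveOn.slope_anti_adjacent ⟨ha.1, (ha.2.trans hp.2).le⟩
      ⟨(hp.1.trans hb.1).le, hb.2⟩ ha.2 hb.1
  have hbdd : BddAbove S := ⟨_, hS 0 ⟨le_rfl, hp.1⟩⟩
  have hne : S.Nonempty := ⟨_, 1, ⟨hp.2, le_rfl⟩, rfl⟩
  refine ⟨sSup S, ?_, fun y hy => ?_⟩
  · refine le_trans ?_ (le_csSup hbdd ⟨1, ⟨hp.2, le_rfl⟩, rfl⟩)
    exact div_nonneg (sub_nonneg.2 (by rw [ψ.map_one]; exact ψ.le_one hp')) (sub_nonneg.2 hp.2.le)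
  · rcases lt_trichotomy y p with h | rfl | h
    · have := csSup_le hne (hS y ⟨hy.1, h⟩)
      rw [le_div_iff₀ (sub_pos.2 h)] at this
      linarith
    · exact le_rfl
    · have := le_csSup hbdd ⟨y, ⟨h, hy.2⟩, rfl⟩
      rw [div_le_iff₀ (sub_pos.2 h)] at this
      linarith

theorem continuousOn_Icc (h0 : Tendsto ψ (𝓝[>] 0) (𝓝 0)) : ContinuousOn ψ (Icc 0 1) := by
  intro x hx
  rcases hx.1.eq_or_lt with rfl | hx0
  · have : ContinuousWithinAt ψ (Ici 0) 0 := by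
      rw [← continuousWithinAt_Ioi_iff_Ici, ContinuousWithinAt, ψ.map_zero]
      exact h0
    exact this.mono Icc_subset_Ici_self
  rcases hx.2.eq_or_lt with rfl | hx1
  · rw [ContinuousWithinAt, ψ.map_one]
    refine tendsto_of_tendsto_of_tendsto_of_le_of_le' (g := id)
      (tendsto_id.mono_left nhdsWithin_le_nhds) tendsto_const_nhds ?_ ?_
    · filter_upwards [self_mem_nhdsWithin] with y hy using ψ.le_apply hy
    · filter_upwards [self_mem_nhdsWithin] with y hy using ψ.le_one hy
  · have := (ψ.concaveOn.subset Ioo_subset_Icc_self (convex_Ioo 0 1)).continuousOn isOpen_Ioo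
    exact (this.continuousAt (isOpen_Ioo.mem_nhds ⟨hx0, hx1⟩)).continuousWithinAt

theorem bddAbove_conj {x : ℝ} (hx : 0 ≤ x) :
    BddAbove (range fun y : Icc (0 : ℝ) 1 => ψ (y : ℝ) - x * (y : ℝ)) := by
  refine ⟨1, ?_⟩
  rintro _ ⟨y, rfl⟩
  have := ψ.le_one y.2
  have := mul_nonneg hx y.2.1
  simp only
  linarith

theorem sub_le_conj {x : ℝ} (hx : 0 ≤ x) {y : ℝ} (hy : y ∈ Icc (0 : ℝ) 1) :
    ψ y - x * y ≤ ψ.conj x :=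
  le_ciSup (ψ.bddAbove_conj hx) ⟨y, hy⟩

section DeterminingSet

variable {Ω : Type*} [MeasurableSpace Ω] {P Q : Measure Ω} [IsProbabilityMeasure P]

/-- Members of the determining set are dominated by the distorted probability `ψ ∘ P`: the bound on
`E (dQ/dP - x)⁺` is used at a supergradient `x` of `ψ` at `P A`. -/
theorem apply_le_of_mem_determiningSet (hQ : Q ∈ ψ.determiningSet P) (A : Set Ω) :
    Q A ≤ ENNReal.ofReal (ψ (P.real A)) := by
  obtain ⟨hprob, hac, hx⟩ := hQ
  have hpm : P.real A ∈ Icc (0 : ℝ) 1 := ⟨measureReal_nonneg, measureReal_le_one⟩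
  rcases hpm.1.eq_or_lt with h0 | h0
  · rw [hac ((measureReal_eq_zero_iff).1 h0.symm)]
    exact zero_le
  rcases hpm.2.eq_or_lt with h1 | h1
  · rw [h1, ψ.map_one, ENNReal.ofReal_one]
    exact prob_le_one
  obtain ⟨x, hx0, hsup⟩ := ψ.exists_supergradient ⟨h0, h1⟩
  have hconj : ψ.conj x ≤ ψ (P.real A) - x * P.real A :=
    haveI : Nonempty (Icc (0 : ℝ) 1) := ⟨⟨0, by simp⟩⟩
    ciSup_le fun y => hsup y y.2
  calc Q A = ∫⁻ ω in A, Q.rnDeriv P ω ∂P := (Measure.setLIntegral_rnDeriv hac A).symm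
    _ ≤ ∫⁻ ω in A, ((Q.rnDeriv P ω - ENNReal.ofReal x) + ENNReal.ofReal x) ∂P :=
      lintegral_mono fun ω => le_tsub_add
    _ = ∫⁻ ω in A, (Q.rnDeriv P ω - ENNReal.ofReal x) ∂P + ENNReal.ofReal x * P A := by
      rw [lintegral_add_right _ measurable_const, setLIntegral_const]
    _ ≤ ENNReal.ofReal (ψ (P.real A) - x * P.real A) + ENNReal.ofReal (x * P.real A) := by
      refine add_le_add ((setLIntegral_le_lintegral _ _).trans ((hx x hx0).trans
        (ENNReal.ofReal_le_ofReal hconj))) ?_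
      rw [ENNReal.ofReal_mul hx0, ofReal_measureReal]
    _ = ENNReal.ofReal (ψ (P.real A)) := by
      rw [← ENNReal.ofReal_add ?_ (mul_nonneg hx0 h0.le), sub_add_cancel]
      have := hsup 0 (by simp)
      simpa [ψ.map_zero] using this

/-- A probability measure dominated by `ψ ∘ P` is in the determining set: the domination is used on
the set `{dQ/dP > x}`. -/
theorem mem_determiningSet [IsProbabilityMeasure Q]
    (h : ∀ A, MeasurableSet A → Q A ≤ ENNReal.ofReal (ψ (P.real A))) : Q ∈ ψ.determiningSet P := by
  have hac : Q ≪ P := Measure.AbsolutelyContinuous.mk fun A hA hPA => by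
    simpa [measureReal_def, hPA, ψ.map_zero] using h A hA
  refine ⟨inferInstance, hac, fun x hx => ?_⟩
  set B := {ω | ENNReal.ofReal x < Q.rnDeriv P ω}
  have hB : MeasurableSet B := measurableSet_lt measurable_const (Measure.measurable_rnDeriv Q P)
  have hpm : P.real B ∈ Icc (0 : ℝ) 1 := ⟨measureReal_nonneg, measureReal_le_one⟩
  calc ∫⁻ ω, (Q.rnDeriv P ω - ENNReal.ofReal x) ∂P
      = ∫⁻ ω in B, (Q.rnDeriv P ω - ENNReal.ofReal x) ∂P := by
        rw [← lintegral_indicator hB]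
        refine lintegral_congr fun ω => ?_
        by_cases hω : ω ∈ B
        · rw [indicator_of_mem hω]
        · rw [indicator_of_notMem hω, tsub_eq_zero_of_le (not_lt.1 hω)]
    _ = Q B - ENNReal.ofReal x * P B := by
        rw [lintegral_sub' aemeasurable_const, setLIntegral_const, Measure.setLIntegral_rnDeriv hac]
        · simpa using ENNReal.mul_ne_top ENNReal.ofReal_ne_top (measure_ne_top P B)
        · exact (ae_restrict_iff' hB).2 (.of_forall fun ω hω => (show _ < _ from hω).le)
    _ ≤ ENNReal.ofReal (ψ (P.real B)) - ENNReal.ofReal (x * P.real B) := by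
        rw [ENNReal.ofReal_mul hx, ofReal_measureReal]
        exact tsub_le_tsub_right (h B hB) _
    _ ≤ ENNReal.ofReal (ψ.conj x) := by
        rw [← ENNReal.ofReal_sub _ (mul_nonneg hx hpm.1)]
        exact ENNReal.ofReal_le_ofReal (ψ.sub_le_conj hx hpm)

end DeterminingSet

section DistortedLaw

variable {ψ} (μ : Measure ℝ)

theorem cdf_mem_Icc (z : ℝ) : cdf μ z ∈ Icc (0 : ℝ) 1 :=
  ⟨cdf_nonneg μ z, cdf_le_one μ z⟩

theorem tendsto_comp_cdf_atTop {f : ℝ → ℝ} (hf : ContinuousOn f (Icc 0 1)) :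
    Tendsto (fun z => f (cdf μ z)) atTop (𝓝 (f 1)) :=
  (hf 1 (by simp)).tendsto.comp
    (tendsto_nhdsWithin_iff.2 ⟨tendsto_cdf_atTop μ, .of_forall (cdf_mem_Icc μ)⟩)

theorem tendsto_comp_cdf_atBot {f : ℝ → ℝ} (hf : ContinuousOn f (Icc 0 1)) :
    Tendsto (fun z => f (cdf μ z)) atBot (𝓝 (f 0)) :=
  (hf 0 (by simp)).tendsto.comp
    (tendsto_nhdsWithin_iff.2 ⟨tendsto_cdf_atBot μ, .of_forall (cdf_mem_Icc μ)⟩)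

theorem continuousWithinAt_comp_cdf {f : ℝ → ℝ} (hf : ContinuousOn f (Icc 0 1)) (z : ℝ) :
    ContinuousWithinAt (fun z => f (cdf μ z)) (Ici z) z :=
  (hf _ (cdf_mem_Icc μ z)).comp ((cdf μ).right_continuous z) fun y _ => cdf_mem_Icc μ y

/-- The Stieltjes function `f ∘ D`, for `f` monotone and continuous on `[0,1]` and `D` the
distribution function of `μ`. -/
noncomputable def compCdf (f : ℝ → ℝ) (hm : MonotoneOn f (Icc 0 1)) (hf : ContinuousOn f (Icc 0 1)) :
    StieltjesFunction ℝ where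
  toFun z := f (cdf μ z)
  mono' _ _ h := hm (cdf_mem_Icc μ _) (cdf_mem_Icc μ _) (monotone_cdf μ h)
  right_continuous' := continuousWithinAt_comp_cdf μ hf

theorem distortedLaw_eq (hψ : ContinuousOn ψ (Icc 0 1)) :
    ψ.distortedLaw μ = (compCdf μ ψ ψ.monotoneOn hψ).measure := by
  rw [distortedLaw]
  congr 1
  ext z
  rw [Monotone.stieltjesFunction_eq]
  exact (compCdf μ ψ ψ.monotoneOn hψ).rightLim_eq z

theorem distortedLaw_Iic (hψ : ContinuousOn ψ (Icc 0 1)) (z : ℝ) :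
    ψ.distortedLaw μ (Iic z) = ENNReal.ofReal (ψ (cdf μ z)) := by
  rw [distortedLaw_eq μ hψ, StieltjesFunction.measure_Iic _ (tendsto_comp_cdf_atBot μ hψ),
    ψ.map_zero, sub_zero]
  rfl

theorem isProbabilityMeasure_distortedLaw (hψ : ContinuousOn ψ (Icc 0 1)) :
    IsProbabilityMeasure (ψ.distortedLaw μ) := ⟨by
  rw [distortedLaw_eq μ hψ, StieltjesFunction.measure_univ _ (tendsto_comp_cdf_atBot μ hψ)
    (tendsto_comp_cdf_atTop μ hψ), ψ.map_zero, ψ.map_one, sub_zero, ENNReal.ofReal_one]⟩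

variable [IsProbabilityMeasure μ]

/-- With `h(y) = ψ(y) - x y` maximal at `p`, the identity
`ψ ∘ D + (h(p) - h(max(D, p))) = x D + h(min(D, p))` between sums of Stieltjes functions turns into one
between measures. As the last summand has total mass `h(p)`, the distorted law exceeds `x μ` by at most
`h(p)` on every set. -/
theorem distortedLaw_le_add (hψ : ContinuousOn ψ (Icc 0 1)) {p x : ℝ} (hp : p ∈ Ioo (0 : ℝ) 1)
    (hx : 0 ≤ x) (hmax : ∀ y ∈ Icc (0 : ℝ) 1, ψ y - x * y ≤ ψ p - x * p) (B : Set ℝ) :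
    ψ.distortedLaw μ B ≤ ENNReal.ofReal x * μ B + ENNReal.ofReal (ψ p - x * p) := by
  have hp' : p ∈ Icc (0 : ℝ) 1 := Ioo_subset_Icc_self hp
  set h : ℝ → ℝ := fun y => ψ y - x * y with hdef
  have hcont : ContinuousOn h (Icc 0 1) := hψ.sub (continuousOn_const.mul continuousOn_id)
  have hconc : ConcaveOn ℝ (Icc 0 1) h :=
    ψ.concaveOn.sub ((convexOn_id (convex_Icc 0 1)).smul hx)
  have hmin : ∀ y ∈ Icc (0 : ℝ) 1, min y p ∈ Icc (0 : ℝ) 1 := fun y hy =>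
    ⟨le_min hy.1 hp'.1, (min_le_left _ _).trans hy.2⟩
  have hmx : ∀ y ∈ Icc (0 : ℝ) 1, max y p ∈ Icc (0 : ℝ) 1 := fun y hy =>
    ⟨hy.1.trans (le_max_left _ _), max_le hy.2 hp'.2⟩
  have m1 : MonotoneOn (fun y => h (min y p)) (Icc 0 1) := by
    intro a ha b hb hab
    have := hconc.min_le_of_mem_Icc (hmin a ha) hp' (z := min b p)
      ⟨min_le_min_right p hab, min_le_right _ _⟩
    rwa [min_eq_left (hmax _ (hmin a ha))] at this
  have m2 : MonotoneOn (fun y => h p - h (max y p)) (Icc 0 1) := by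
    intro a ha b hb hab
    have := hconc.min_le_of_mem_Icc hp' (hmx b hb) (z := max a p)
      ⟨le_max_right _ _, max_le_max_right p hab⟩
    rw [min_eq_right (hmax _ (hmx b hb))] at this
    exact sub_le_sub_left this _
  have c1 : ContinuousOn (fun y => h (min y p)) (Icc 0 1) :=
    hcont.comp (by fun_prop) hmin
  have c2 : ContinuousOn (fun y => h p - h (max y p)) (Icc 0 1) :=
    continuousOn_const.sub (hcont.comp (by fun_prop) hmx)
  have key : compCdf μ ψ ψ.monotoneOn hψ + compCdf μ _ m2 c2
      = x.toNNReal • cdf μ + compCdf μ _ m1 c1 := by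
    ext z
    change ψ (cdf μ z) + (h p - h (max (cdf μ z) p))
      = (x.toNNReal : ℝ) * cdf μ z + h (min (cdf μ z) p)
    rw [Real.coe_toNNReal _ hx]
    rcases le_total (cdf μ z) p with hz | hz
    · rw [max_eq_right hz, min_eq_left hz]; simp only [hdef]; ring
    · rw [max_eq_left hz, min_eq_right hz]; simp only [hdef]; ring
  have hmeas := congrArg (fun f => StieltjesFunction.measure f B) key
  simp only [StieltjesFunction.measure_add, StieltjesFunction.measure_smul, measure_cdf,
    Measure.add_apply, ← distortedLaw_eq μ hψ] at hmeas
  calc ψ.distortedLaw μ B ≤ _ := le_self_add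
    _ = _ := hmeas
    _ ≤ _ := by
      refine add_le_add le_rfl ((measure_mono (subset_univ B)).trans ?_)
      rw [StieltjesFunction.measure_univ _ (tendsto_comp_cdf_atBot μ c1)
        (tendsto_comp_cdf_atTop μ c1), min_eq_left hp.1.le, min_eq_right hp.2.le]
      simp [hdef, ψ.map_zero]

/-- The distorted law is dominated by `ψ ∘ μ` on all sets, not only on half-lines. -/
theorem distortedLaw_apply_le (hψ : ContinuousOn ψ (Icc 0 1)) (B : Set ℝ) :
    ψ.distortedLaw μ B ≤ ENNReal.ofReal (ψ (μ.real B)) := by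
  have hpm : μ.real B ∈ Icc (0 : ℝ) 1 := ⟨measureReal_nonneg, measureReal_le_one⟩
  have := isProbabilityMeasure_distortedLaw μ hψ
  rcases hpm.2.eq_or_lt with h1 | h1
  · rw [h1, ψ.map_one, ENNReal.ofReal_one]
    exact prob_le_one
  rcases hpm.1.eq_or_lt with h0 | h0
  · have hB : μ B = 0 := (measureReal_eq_zero_iff).1 h0.symm
    rw [← h0]
    have hlim : Tendsto (fun q => ENNReal.ofReal (ψ q)) (𝓝[>] 0) (𝓝 (ENNReal.ofReal (ψ 0))) := by
      refine ENNReal.tendsto_ofReal (((hψ 0 (by simp)).tendsto).mono_left ?_)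
      rw [← nhdsWithin_Ioo_eq_nhdsGT one_pos]
      exact nhdsWithin_mono _ Ioo_subset_Icc_self
    refine ge_of_tendsto hlim ?_
    filter_upwards [Ioo_mem_nhdsGT one_pos] with q hq
    obtain ⟨x, hx0, hsup⟩ := ψ.exists_supergradient hq
    refine (distortedLaw_le_add μ hψ hq hx0 hsup B).trans ?_
    rw [hB, mul_zero, zero_add]
    exact ENNReal.ofReal_le_ofReal (by linarith [mul_nonneg hx0 hq.1.le])
  · obtain ⟨x, hx0, hsup⟩ := ψ.exists_supergradient ⟨h0, h1⟩
    refine (distortedLaw_le_add μ hψ ⟨h0, h1⟩ hx0 hsup B).trans_eq ?_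
    have := hsup 0 (by simp)
    rw [← ofReal_measureReal, ← ENNReal.ofReal_mul hx0,
      ← ENNReal.ofReal_add (mul_nonneg hx0 h0.le) (by simpa [ψ.map_zero] using this)]
    congr 1
    ring

end DistortedLaw

section Extreme

variable {ψ} {Ω : Type*} [MeasurableSpace Ω] {P : Measure Ω}

/-- For `ψ` continuous, the distorted law of `X` is the law of `X` under a member of the determining
set: its density is the Radon–Nikodym derivative of the distorted law, evaluated at `X`. -/
theorem exists_mem_determiningSet_map_eq [IsProbabilityMeasure P]
    (hψ : ContinuousOn ψ (Icc 0 1)) {X : Ω → ℝ} (hX : Measurable X) :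
    ∃ Q ∈ ψ.determiningSet P, Q.map X = ψ.distortedLaw (P.map X) := by
  have := Measure.isProbabilityMeasure_map (μ := P) hX.aemeasurable
  have := isProbabilityMeasure_distortedLaw (P.map X) hψ
  obtain ⟨-, hac, hx⟩ := ψ.mem_determiningSet (P := P.map X) (Q := ψ.distortedLaw (P.map X))
    fun A _ => distortedLaw_apply_le _ hψ A
  set ν := ψ.distortedLaw (P.map X)
  set g := ν.rnDeriv (P.map X)
  have hg : Measurable g := Measure.measurable_rnDeriv _ _
  have hmap : (P.withDensity (g ∘ X)).map X = ν := by
    ext A hA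
    rw [Measure.map_apply hX hA, withDensity_apply _ (hX hA), ← Measure.setLIntegral_rnDeriv hac A,
      setLIntegral_map hA hg hX]
    rfl
  refine ⟨P.withDensity (g ∘ X), ⟨?_, withDensity_absolutelyContinuous _ _, fun x hx0 => ?_⟩, hmap⟩
  · refine ⟨?_⟩
    rw [← preimage_univ (f := X), ← Measure.map_apply hX MeasurableSet.univ, hmap, measure_univ]
  · rw [lintegral_congr_ae ((Measure.rnDeriv_withDensity P (hg.comp hX)).mono fun ω hω => by
      rw [hω, Function.comp])]
    rw [← lintegral_map (f := fun z => g z - ENNReal.ofReal x) (hg.sub_const _) hX]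
    exact hx x hx0

theorem distortedMean_eq_extendedMean (hψ : ContinuousOn ψ (Icc 0 1)) {X : Ω → ℝ}
    (hX : Measurable X) {Q : Measure Ω} (hQ : Q.map X = ψ.distortedLaw (P.map X)) :
    ψ.distortedMean (P.map X) = extendedMean Q X := by
  have hbot : ψ.massAtBot (P.map X) = 0 := by
    have hlim := ENNReal.tendsto_ofReal (tendsto_comp_cdf_atBot (P.map X) hψ)
    rw [ψ.map_zero, ENNReal.ofReal_zero] at hlim
    exact le_antisymm (ge_of_tendsto hlim (.of_forall fun z => iInf_le _ z)) zero_le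
  rw [distortedMean, extendedMean, hbot, mul_zero, add_zero, ← hQ,
    lintegral_map (by fun_prop) hX, lintegral_map (by fun_prop) hX]

end Extreme

end ConcaveDistortion

section Dominance

variable {Ω : Type*} [MeasurableSpace Ω]

/-- The extended mean respects first-order stochastic dominance. -/
theorem extendedMean_le_of_measure_le {Q R : Measure Ω} [IsProbabilityMeasure Q]
    [IsProbabilityMeasure R] {X : Ω → ℝ} (hX : Measurable X)
    (h : ∀ z, R {ω | X ω ≤ z} ≤ Q {ω | X ω ≤ z}) : extendedMean Q X ≤ extendedMean R X := by
  have hpos : ∀ S : Measure Ω, ∫⁻ ω, ENNReal.ofReal (X ω) ∂S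
      = ∫⁻ t in Ioi 0, S {ω | t < X ω} := fun S => by
    have e : ∀ ω, ENNReal.ofReal (X ω) = ENNReal.ofReal (max (X ω) 0) := fun ω => by
      rw [ENNReal.ofReal_max, ENNReal.ofReal_zero, max_eq_left zero_le]
    simp_rw [e]
    rw [lintegral_eq_lintegral_meas_lt (f := fun ω => max (X ω) 0) S
      (.of_forall fun ω => le_max_right _ _)
      (by fun_prop)]
    refine setLIntegral_congr_fun measurableSet_Ioi fun t ht => ?_
    have ht : 0 < t := ht
    simp [ht.not_gt]
  have hneg : ∀ S : Measure Ω, ∫⁻ ω, ENNReal.ofReal (-X ω) ∂S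
      = ∫⁻ t in Ioi 0, S {ω | X ω ≤ -t} := fun S => by
    have e : ∀ ω, ENNReal.ofReal (-X ω) = ENNReal.ofReal (max (-X ω) 0) := fun ω => by
      rw [ENNReal.ofReal_max, ENNReal.ofReal_zero, max_eq_left zero_le]
    simp_rw [e]
    rw [lintegral_eq_lintegral_meas_le (f := fun ω => max (-X ω) 0) S
      (.of_forall fun ω => le_max_right _ _)
      (by fun_prop)]
    refine setLIntegral_congr_fun measurableSet_Ioi fun t ht => ?_
    have ht : 0 < t := ht
    simp [ht.not_ge, le_neg]
  refine EReal.sub_le_sub ?_ ?_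
  · rw [hpos, hpos]
    refine EReal.coe_ennreal_le_coe_ennreal_iff.2 (lintegral_mono fun t => ?_)
    have e : {ω | t < X ω} = {ω | X ω ≤ t}ᶜ := by ext; simp
    have hm : MeasurableSet {ω | X ω ≤ t} := measurableSet_le hX measurable_const
    rw [e, prob_compl_eq_one_sub hm, prob_compl_eq_one_sub hm]
    exact tsub_le_tsub_left (h t) _
  · rw [hneg, hneg]
    exact EReal.coe_ennreal_le_coe_ennreal_iff.2 (lintegral_mono fun t => h _)

end Dominance

namespace ConcaveDistortion

variable {ψ : ConcaveDistortion} {Ω : Type*} [MeasurableSpace Ω] {P : Measure Ω}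
  [IsProbabilityMeasure P]

theorem cdf_map_eq {X : Ω → ℝ} (hX : Measurable X) (z : ℝ) :
    cdf (P.map X) z = P.real {ω | X ω ≤ z} := by
  have := Measure.isProbabilityMeasure_map (μ := P) hX.aemeasurable
  rw [cdf_eq_real, map_measureReal_apply hX measurableSet_Iic]
  rfl

theorem nonempty_extremeMeasures (hψ : ContinuousOn ψ (Icc 0 1)) {X : Ω → ℝ} (hX : Measurable X) :
    (extremeMeasures (ψ.determiningSet P) X).Nonempty := by
  have := Measure.isProbabilityMeasure_map (μ := P) hX.aemeasurable
  obtain ⟨Q, hQ, hmap⟩ := exists_mem_determiningSet_map_eq (P := P) hψ hX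
  refine ⟨Q, hQ, fun R hR => ?_⟩
  have := hQ.1
  have := hR.1
  refine extendedMean_le_of_measure_le hX fun z => ?_
  have e : Q {ω | X ω ≤ z} = Q.map X (Iic z) := (Measure.map_apply hX measurableSet_Iic).symm
  rw [e, hmap, distortedLaw_Iic _ hψ, cdf_map_eq hX]
  exact ψ.apply_le_of_mem_determiningSet hR _

end ConcaveDistortion

/-! ### Random variables on an atomless space, and extreme measures -/

section Atomless

variable {Ω : Type*} [MeasurableSpace Ω] {P : Measure Ω} [IsFiniteMeasure P]

theorem IsAtomless.exists_subset_half (hP : IsAtomless P) {A : Set Ω} (hA : MeasurableSet A)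
    (hA0 : 0 < P A) : ∃ B ⊆ A, MeasurableSet B ∧ 0 < P B ∧ P B ≤ P A / 2 := by
  obtain ⟨B, hBA, hB, hB0, hlt⟩ := hP A hA hA0
  rcases le_or_gt (P B) (P A / 2) with h | h
  · exact ⟨B, hBA, hB, hB0, h⟩
  · refine ⟨A \ B, sdiff_subset, hA.diff hB, ?_, ?_⟩
    · rw [measure_sdiff hBA hB.nullMeasurableSet (measure_ne_top P B)]
      exact tsub_pos_of_lt hlt
    · rw [measure_sdiff hBA hB.nullMeasurableSet (measure_ne_top P B), tsub_le_iff_right]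
      calc P A = P A / 2 + P A / 2 := (ENNReal.add_halves _).symm
        _ ≤ P A / 2 + P B := by gcongr

theorem IsAtomless.exists_subset_le (hP : IsAtomless P) {A : Set Ω} (hA : MeasurableSet A)
    (hA0 : 0 < P A) {δ : ℝ≥0∞} (hδ : 0 < δ) : ∃ B ⊆ A, MeasurableSet B ∧ 0 < P B ∧ P B ≤ δ := by
  have key : ∀ n : ℕ, ∃ B ⊆ A, MeasurableSet B ∧ 0 < P B ∧ P B ≤ P A * 2⁻¹ ^ n := fun n => by
    induction n with
    | zero => exact ⟨A, Subset.rfl, hA, hA0, by simp⟩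
    | succ n ih =>
      obtain ⟨B, hBA, hB, hB0, hle⟩ := ih
      obtain ⟨C, hCB, hC, hC0, hle'⟩ := hP.exists_subset_half hB hB0
      refine ⟨C, hCB.trans hBA, hC, hC0, hle'.trans ?_⟩
      rw [pow_succ, ← mul_assoc, ENNReal.div_eq_inv_mul, mul_comm]
      gcongr
  have hlim : Tendsto (fun n : ℕ => P A * 2⁻¹ ^ n) atTop (𝓝 (P A * 0)) :=
    ENNReal.Tendsto.const_mul (ENNReal.tendsto_pow_atTop_nhds_zero_of_lt_one (by simp))
      (.inr (measure_ne_top P A))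
  rw [mul_zero] at hlim
  obtain ⟨n, hn⟩ := (hlim.eventually (gt_mem_nhds hδ)).exists
  obtain ⟨B, hBA, hB, hB0, hle⟩ := key n
  exact ⟨B, hBA, hB, hB0, hle.trans hn.le⟩

theorem IsAtomless.exists_antitone_seq [NeZero P] (hP : IsAtomless P) {ε : ℕ → ℝ≥0∞}
    (hε : ∀ n, 0 < ε n) :
    ∃ A : ℕ → Set Ω, Antitone A ∧ ∀ n, MeasurableSet (A n) ∧ 0 < P (A n) ∧ P (A n) ≤ ε n := by
  have step : ∀ (n : ℕ) (A : {A : Set Ω // MeasurableSet A ∧ 0 < P A}),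
      ∃ B : {A : Set Ω // MeasurableSet A ∧ 0 < P A}, B.1 ⊆ A.1 ∧ P B.1 ≤ ε n := fun n A => by
    obtain ⟨B, hBA, hB, hB0, hle⟩ := hP.exists_subset_le A.2.1 A.2.2 (hε n)
    exact ⟨⟨B, hB, hB0⟩, hBA, hle⟩
  choose f hf using step
  let u : ℕ → {A : Set Ω // MeasurableSet A ∧ 0 < P A} := fun n =>
    Nat.rec ⟨univ, MeasurableSet.univ, NeZero.pos _⟩ (fun n A => f n A) n
  refine ⟨fun n => (u (n + 1)).1, antitone_nat_of_succ_le fun n => (hf (n + 1) (u (n + 1))).1,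
    fun n => ⟨(u (n + 1)).2.1, (u (n + 1)).2.2, (hf n (u n)).2⟩⟩

/-- An atomless space carries an unbounded nonnegative random variable, the number of the sets `A n`
that contain a point, where the `A n` decrease as fast as desired. -/
theorem IsAtomless.exists_unbounded [NeZero P] (hP : IsAtomless P) {ε : ℕ → ℝ≥0∞}
    (hε : ∀ n, 0 < ε n) (hsum : ∑' n, ε n ≠ ∞) :
    ∃ (A : ℕ → Set Ω) (N : Ω → ℝ), (∀ n, MeasurableSet (A n)) ∧ (∀ n, P (A n) ≤ ε n) ∧
      Measurable N ∧ (∀ ω, 0 ≤ N ω) ∧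
      (∀ ω, ENNReal.ofReal (N ω) ≤ ∑' n, (A n).indicator 1 ω) ∧
      ∀ n : ℕ, 0 < P {ω | n ≤ N ω} := by
  obtain ⟨A, hanti, hA⟩ := hP.exists_antitone_seq hε
  have hmeas : Measurable fun ω => ∑' n, (A n).indicator (1 : Ω → ℝ≥0∞) ω :=
    Measurable.tsum fun n => measurable_one.indicator (hA n).1
  refine ⟨A, fun ω => (∑' n, (A n).indicator (1 : Ω → ℝ≥0∞) ω).toReal, fun n => (hA n).1,
    fun n => (hA n).2.2, hmeas.ennreal_toReal, fun ω => ENNReal.toReal_nonneg,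
    fun ω => ENNReal.ofReal_toReal_le, fun n => ?_⟩
  have hfin : ∀ᵐ ω ∂P, ∑' n, (A n).indicator (1 : Ω → ℝ≥0∞) ω < ∞ := by
    refine ae_lt_top hmeas ?_
    rw [lintegral_tsum fun n => (measurable_one.indicator (hA n).1).aemeasurable]
    refine ne_top_of_le_ne_top hsum (ENNReal.tsum_le_tsum fun n => ?_)
    rw [lintegral_indicator_one (hA n).1]
    exact (hA n).2.2
  refine (hA n).2.1.trans_le (measure_mono_ae ?_)
  filter_upwards [hfin] with ω hω hωA
  have hle : (n : ℝ≥0∞) ≤ ∑' k, (A k).indicator (1 : Ω → ℝ≥0∞) ω := by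
    refine le_trans ?_ (ENNReal.sum_le_tsum (Finset.range n))
    rw [Finset.sum_congr rfl fun k hk => indicator_of_mem
      (hanti (Finset.mem_range.1 hk).le hωA) (1 : Ω → ℝ≥0∞)]
    simp
  have := ENNReal.toReal_mono hω.ne hle
  rwa [ENNReal.toReal_natCast] at this

end Atomless

namespace ConcaveDistortion

variable {ψ : ConcaveDistortion} {Ω : Type*} [MeasurableSpace Ω] {P : Measure Ω}
  [IsProbabilityMeasure P]

/-- For `ψ` continuous at `0`, there are random variables that are unbounded below and have a
nonnegative distorted mean: the tails are made so small that the distortion keeps them integrable. -/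
theorem exists_essInf_eq_bot (hP : IsAtomless P) (h0 : Tendsto ψ (𝓝[>] 0) (𝓝 0)) :
    ∃ X : Ω → ℝ, Measurable X ∧ essInf (fun ω => (X ω : EReal)) P = ⊥ ∧
      0 ≤ ψ.distortedMean (P.map X) := by
  have hψ := ψ.continuousOn_Icc h0
  obtain ⟨η, hη, hsum⟩ := ENNReal.exists_pos_sum_of_countable' (ε := 2⁻¹) (by simp) ℕ
  have hδ : ∀ n, ∃ δ ∈ Ioo (0 : ℝ) 1, ENNReal.ofReal (ψ δ) < η n := fun n => by
    have hlim := ENNReal.tendsto_ofReal h0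
    rw [ENNReal.ofReal_zero] at hlim
    obtain ⟨δ, h1, h2⟩ := ((hlim.eventually (gt_mem_nhds (hη n))).and
      (Ioo_mem_nhdsGT one_pos)).exists
    exact ⟨δ, h2, h1⟩
  choose δ hδ hδη using hδ
  have hle : ∀ n, ENNReal.ofReal (δ n) ≤ η n := fun n =>
    (ENNReal.ofReal_le_ofReal (ψ.le_apply (Ioo_subset_Icc_self (hδ n)))).trans (hδη n).le
  obtain ⟨A, N, hAm, hA, hN, hN0, hNA, hunb⟩ := hP.exists_unbounded
    (ε := fun n => ENNReal.ofReal (δ n)) (fun n => ENNReal.ofReal_pos.2 (hδ n).1)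
    (ne_top_of_le_ne_top (hsum.trans (by simp)).ne (ENNReal.tsum_le_tsum hle))
  have hX : Measurable fun ω => 1 - N ω := measurable_const.sub hN
  refine ⟨fun ω => 1 - N ω, hX, ?_, ?_⟩
  · rw [essInf_eq_sSup, sSup_eq_bot]
    intro a ha
    by_contra hne
    obtain ⟨r, -, hr⟩ := EReal.lt_iff_exists_real_btwn.1 (bot_lt_iff_ne_bot.2 hne)
    obtain ⟨n, hn⟩ := exists_nat_gt (1 - r)
    refine (hunb n).ne' (measure_mono_null (fun ω hω => ?_) ha)
    have hω : (n : ℝ) ≤ N ω := hω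
    exact lt_of_le_of_lt (EReal.coe_le_coe_iff.2 (by linarith)) hr
  · obtain ⟨Q, hQ, hmap⟩ := exists_mem_determiningSet_map_eq (P := P) hψ hX
    have := hQ.1
    rw [distortedMean_eq_extendedMean hψ hX hmap]
    have hQN : ∫⁻ ω, ENNReal.ofReal (N ω) ∂Q ≤ 2⁻¹ := by
      calc ∫⁻ ω, ENNReal.ofReal (N ω) ∂Q ≤ ∫⁻ ω, ∑' n, (A n).indicator 1 ω ∂Q :=
            lintegral_mono hNA
        _ = ∑' n, Q (A n) := by
            rw [lintegral_tsum fun n => (measurable_one.indicator (hAm n)).aemeasurable]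
            simp_rw [lintegral_indicator_one (hAm _)]
        _ ≤ ∑' n, η n := ENNReal.tsum_le_tsum fun n => by
            refine (ψ.apply_le_of_mem_determiningSet hQ (A n)).trans
              ((ENNReal.ofReal_le_ofReal ?_).trans (hδη n).le)
            exact ψ.monotoneOn ⟨measureReal_nonneg, measureReal_le_one⟩
              (Ioo_subset_Icc_self (hδ n)) (ENNReal.toReal_le_of_le_ofReal (hδ n).1.le (hA n))
        _ ≤ 2⁻¹ := hsum.le
    have hneg : ∫⁻ ω, ENNReal.ofReal (-(1 - N ω)) ∂Q ≤ 2⁻¹ :=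
      (lintegral_mono fun ω => ENNReal.ofReal_le_ofReal (by linarith)).trans hQN
    have hpos : 2⁻¹ ≤ ∫⁻ ω, ENNReal.ofReal (1 - N ω) ∂Q := by
      have h1 : (1 : ℝ≥0∞) ≤ ∫⁻ ω, ENNReal.ofReal (1 - N ω) ∂Q + 2⁻¹ := by
        calc (1 : ℝ≥0∞) = ∫⁻ _, 1 ∂Q := by simp
          _ ≤ ∫⁻ ω, (ENNReal.ofReal (1 - N ω) + ENNReal.ofReal (N ω)) ∂Q :=
            lintegral_mono fun ω => by
              refine le_trans ?_ ENNReal.ofReal_add_le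
              simp
          _ = ∫⁻ ω, ENNReal.ofReal (1 - N ω) ∂Q + ∫⁻ ω, ENNReal.ofReal (N ω) ∂Q :=
            lintegral_add_left (by fun_prop) _
          _ ≤ _ := by gcongr
      have h2 := tsub_le_iff_right.2 h1
      rwa [ENNReal.one_sub_inv_two] at h2
    rw [extendedMean, EReal.sub_nonneg]
    · exact EReal.coe_ennreal_le_coe_ennreal_iff.2 (hneg.trans hpos)
    · right; exact mt EReal.coe_ennreal_eq_top_iff.1 (ne_top_of_le_ne_top (by simp) hneg)
    · left; simp

/-- A random variable that is unbounded below can have a nonnegative distorted mean only if no mass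
is placed at `-∞`, i.e. if `ψ` is continuous at `0`. -/
theorem tendsto_zero_of_essInf_eq_bot {X : Ω → ℝ} (hX : Measurable X)
    (hinf : essInf (fun ω => (X ω : EReal)) P = ⊥) (h : 0 ≤ ψ.distortedMean (P.map X)) :
    Tendsto ψ (𝓝[>] 0) (𝓝 0) := by
  have hD : ∀ z, 0 < cdf (P.map X) z := fun z => by
    refine lt_of_le_of_ne (cdf_nonneg _ _) fun he => ?_
    rw [cdf_map_eq hX, eq_comm, measureReal_eq_zero_iff] at he
    have : (z : EReal) ≤ essInf (fun ω => (X ω : EReal)) P := by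
      refine le_essInf_of_ae_le _ ?_
      have : ∀ᵐ ω ∂P, ¬ X ω ≤ z := by rw [ae_iff]; simpa using he
      filter_upwards [this] with ω hω
      exact EReal.coe_le_coe_iff.2 (not_le.1 hω).le
    rw [hinf, le_bot_iff] at this
    exact EReal.coe_ne_bot z this
  have hmass : ψ.massAtBot (P.map X) = 0 := by
    by_contra hne
    rw [distortedMean, ENNReal.top_mul hne, add_top, EReal.coe_ennreal_top, EReal.sub_top] at h
    simp at h
  refine tendsto_order.2 ⟨fun a ha => ?_, fun a ha => ?_⟩
  · filter_upwards [Ioo_mem_nhdsGT one_pos] with x hx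
    exact ha.trans_le (ψ.nonneg (Ioo_subset_Icc_self hx))
  · have hlt : ψ.massAtBot (P.map X) < ENNReal.ofReal a := by
      rw [hmass]; exact ENNReal.ofReal_pos.2 ha
    obtain ⟨z, hz⟩ := iInf_lt_iff.1 hlt
    filter_upwards [Ioo_mem_nhdsGT (hD z)] with x hx
    refine (ψ.monotoneOn ⟨hx.1.le, hx.2.le.trans (cdf_le_one _ _)⟩ (cdf_mem_Icc _ z)
      hx.2.le).trans_lt ?_
    exact (ENNReal.ofReal_lt_ofReal_iff ha).1 hz

/-- Random variables that are bounded below have a distorted mean greater than `-∞`, even if `ψ` jumps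
at `0`. -/
theorem bot_lt_distortedMean {X : Ω → ℝ} (hX : Measurable X) {a : ℝ} (ha : ∀ ω, a ≤ X ω) :
    ⊥ < ψ.distortedMean (P.map X) := by
  have hD : ∀ z < a, cdf (P.map X) z = 0 := fun z hz => by
    rw [cdf_map_eq hX, (_ : {ω | X ω ≤ z} = ∅), measureReal_empty]
    exact eq_empty_of_forall_notMem fun ω hω => (hz.trans_le (ha ω)).not_ge hω
  have hmass : ψ.massAtBot (P.map X) = 0 := by
    refine le_antisymm ((iInf_le _ (a - 1)).trans ?_) zero_le
    rw [hD _ (by linarith), ψ.map_zero, ENNReal.ofReal_zero]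
  set hm := ψ.monotone_comp_cdf (P.map X)
  have hF0 : ∀ z < a, hm.stieltjesFunction z = 0 := fun z hz => by
    obtain ⟨w, hzw, hwa⟩ := exists_between hz
    rw [Monotone.stieltjesFunction_eq]
    refine le_antisymm ((hm.rightLim_le hzw).trans ?_) (le_trans ?_ (hm.le_rightLim le_rfl))
    · simp only [hD w hwa, ψ.map_zero, le_rfl]
    · exact ψ.nonneg (cdf_mem_Icc _ z)
  have hF1 : ∀ z, hm.stieltjesFunction z ≤ 1 := fun z =>
    (hm.rightLim_le (lt_add_one z)).trans (ψ.le_one (cdf_mem_Icc _ _))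
  have hbot : Tendsto hm.stieltjesFunction atBot (𝓝 0) :=
    tendsto_const_nhds.congr' ((eventually_lt_atBot a).mono fun z hz => (hF0 z hz).symm)
  have htop := tendsto_atTop_ciSup hm.stieltjesFunction.mono ⟨1, by rintro _ ⟨z, rfl⟩; exact hF1 z⟩
  have huniv := StieltjesFunction.measure_univ _ hbot htop
  have hnull : ψ.distortedLaw (P.map X) (Iic (a - 1)) = 0 := by
    rw [distortedLaw, StieltjesFunction.measure_Iic _ hbot, hF0 _ (by linarith)]
    simp
  have hfin : ∫⁻ x, ENNReal.ofReal (-x) ∂(ψ.distortedLaw (P.map X)) < ∞ := by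
    have hae : ∀ᵐ x ∂(ψ.distortedLaw (P.map X)),
        ENNReal.ofReal (-x) ≤ ENNReal.ofReal (1 - a) := by
      have : ∀ᵐ x ∂(ψ.distortedLaw (P.map X)), x ∉ Iic (a - 1) := by
        simp only [ae_iff, not_not]
        exact hnull
      filter_upwards [this] with x hx
      have hx : a - 1 < x := not_le.1 hx
      exact ENNReal.ofReal_le_ofReal (by linarith)
    refine (lintegral_mono_ae hae).trans_lt ?_
    rw [lintegral_const, distortedLaw, huniv]
    exact ENNReal.mul_lt_top ENNReal.ofReal_lt_top ENNReal.ofReal_lt_top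
  rw [distortedMean, hmass, mul_zero, add_zero]
  lift (∫⁻ x, ENNReal.ofReal (-x) ∂(ψ.distortedLaw (P.map X))) to ℝ≥0 using hfin.ne with b
  rw [sub_eq_add_neg, EReal.bot_lt_add_iff]
  refine ⟨(EReal.bot_lt_zero).trans_le (EReal.coe_ennreal_nonneg _), ?_⟩
  rw [bot_lt_iff_ne_bot, Ne, EReal.neg_eq_bot_iff, EReal.coe_ennreal_eq_top_iff]
  exact ENNReal.coe_ne_top

/-- The largest concave distortion below `ψ` that is linear on `[0,δ]`: it is continuous at `0` and
coincides with `ψ` on `[δ,1]`. -/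
noncomputable def linearize (ψ : ConcaveDistortion) {δ : ℝ} (hδ : δ ∈ Ioc (0 : ℝ) 1) :
    ConcaveDistortion where
  toFun x := min (ψ x) (x * (ψ δ / δ))
  concaveOn := by
    refine ψ.concaveOn.inf ?_
    exact ⟨convex_Icc 0 1, fun x _ y _ a b _ _ _ => le_of_eq (by simp only [smul_eq_mul]; ring)⟩
  monotoneOn x hx y hy hxy := min_le_min (ψ.monotoneOn hx hy hxy)
    (mul_le_mul_of_nonneg_right hxy (div_nonneg (ψ.nonneg (Ioc_subset_Icc_self hδ)) hδ.1.le))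
  map_zero := by simp [ψ.map_zero]
  map_one := by
    rw [ψ.map_one, one_mul, min_eq_left]
    exact (one_le_div hδ.1).2 (ψ.le_apply (Ioc_subset_Icc_self hδ))

theorem linearize_le {δ : ℝ} (hδ : δ ∈ Ioc (0 : ℝ) 1) (x : ℝ) : ψ.linearize hδ x ≤ ψ x :=
  min_le_left _ _

theorem linearize_eq {δ : ℝ} (hδ : δ ∈ Ioc (0 : ℝ) 1) {x : ℝ} (hx : x ∈ Icc δ 1) :
    ψ.linearize hδ x = ψ x := by
  refine min_eq_left ?_
  rw [mul_div_assoc', le_div_iff₀ hδ.1, mul_comm x]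
  exact ψ.apply_mul_le hδ.1.le hx.1 hx.2

theorem continuousOn_linearize {δ : ℝ} (hδ : δ ∈ Ioc (0 : ℝ) 1) :
    ContinuousOn (ψ.linearize hδ) (Icc 0 1) := by
  refine continuousOn_Icc _ (tendsto_of_tendsto_of_tendsto_of_le_of_le' (g := fun _ => 0)
    (h := fun x => x * (ψ δ / δ)) tendsto_const_nhds ?_ ?_ ?_)
  · have : Tendsto (fun x : ℝ => x * (ψ δ / δ)) (𝓝 0) (𝓝 (0 * (ψ δ / δ))) :=
      (continuous_id.mul continuous_const).tendsto 0
    rw [zero_mul] at this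
    exact this.mono_left nhdsWithin_le_nhds
  · filter_upwards [Ioo_mem_nhdsGT one_pos] with x hx
    exact nonneg _ (Ioo_subset_Icc_self hx)
  · exact .of_forall fun x => min_le_right _ _

theorem determiningSet_mono {φ : ConcaveDistortion} (h : ∀ x, φ x ≤ ψ x) :
    φ.determiningSet P ⊆ ψ.determiningSet P := fun Q hQ => by
  have := hQ.1
  exact ψ.mem_determiningSet fun A _ => (φ.apply_le_of_mem_determiningSet hQ A).trans
    (ENNReal.ofReal_le_ofReal (h _))

/-- If `ψ` jumps at `0`, then a positive random variable with essential infimum `0` has no extreme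
measure: an optimal one would have to put the mass `c` of the jump on the null set `{X = 0}`. -/
theorem not_nonempty_extremeMeasures {c : ℝ} (hc0 : 0 < c) (hc : ∀ x ∈ Ioc (0 : ℝ) 1, c ≤ ψ x)
    {X : Ω → ℝ} (hX : Measurable X) (hX0 : ∀ ω, 0 < X ω) (hX1 : ∀ ω, X ω ≤ 1)
    (hinf : ∀ z, 0 < z → 0 < P {ω | X ω ≤ z}) :
    ¬ (extremeMeasures (ψ.determiningSet P) X).Nonempty := by
  rintro ⟨Q, hQ, hmin⟩
  have hQp := hQ.1
  have hc1 : c ≤ 1 := ψ.map_one ▸ hc 1 (by simp)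
  have hms : ∀ z, MeasurableSet {ω | X ω ≤ z} := fun z => measurableSet_le hX measurable_const
  have hP' : ∀ z, 0 < z → P.real {ω | X ω ≤ z} ∈ Ioc (0 : ℝ) 1 := fun z hz =>
    ⟨ENNReal.toReal_pos (hinf z hz).ne' (measure_ne_top _ _), measureReal_le_one⟩
  obtain ⟨η, hη0, hη⟩ : ∃ η : ℝ, 0 < η ∧ Q {ω | X ω ≤ η} ≤ ENNReal.ofReal (c / 2) := by
    have hlim := tendsto_measure_iInter_atTop (μ := Q)
      (s := fun n : ℕ => {ω | X ω ≤ 1 / ((n : ℝ) + 1)})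
      (fun n => (hms _).nullMeasurableSet)
      (fun m n hmn ω hω => (show X ω ≤ _ from hω).trans (by gcongr)) ⟨0, measure_ne_top _ _⟩
    have hempty : ⋂ n : ℕ, {ω | X ω ≤ 1 / ((n : ℝ) + 1)} = ∅ := by
      refine eq_empty_of_forall_notMem fun ω hω => ?_
      obtain ⟨n, hn⟩ := exists_nat_one_div_lt (hX0 ω)
      exact hn.not_ge (mem_iInter.1 hω n)
    rw [hempty, measure_empty] at hlim
    obtain ⟨n, hn⟩ := (hlim.eventually
      (gt_mem_nhds (ENNReal.ofReal_pos.2 (half_pos hc0)))).exists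
    exact ⟨_, by positivity, hn.le⟩
  -- below `z₀` the competitor may be worse, but this costs less than it gains on `[z₀, η]`
  set z₀ := η * c / 8
  have hz₀ : 0 < z₀ := by positivity
  set φ := ψ.linearize (hP' z₀ hz₀)
  have hφ := continuousOn_linearize (ψ := ψ) (hP' z₀ hz₀)
  obtain ⟨Q₁, hQ₁, hmap⟩ := exists_mem_determiningSet_map_eq (P := P) hφ hX
  have hQ₁p := hQ₁.1
  have := Measure.isProbabilityMeasure_map (μ := P) hX.aemeasurable
  have hQ₁X : ∀ z, Q₁ {ω | X ω ≤ z} = ENNReal.ofReal (φ (P.real {ω | X ω ≤ z})) := fun z => by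
    have e : Q₁ {ω | X ω ≤ z} = Q₁.map X (Iic z) := (Measure.map_apply hX measurableSet_Iic).symm
    rw [e, hmap, distortedLaw_Iic _ hφ, cdf_map_eq hX]
  have hQ₁X' : ∀ z, z₀ ≤ z → Q₁ {ω | X ω ≤ z} = ENNReal.ofReal (ψ (P.real {ω | X ω ≤ z})) := by
    intro z hz
    rw [hQ₁X, linearize_eq]
    exact ⟨measureReal_mono fun ω hω => (show X ω ≤ _ from hω).trans hz, measureReal_le_one⟩
  have hcompl : ∀ (S : Measure Ω) [IsProbabilityMeasure S] (z : ℝ),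
      S {ω | z < X ω} = 1 - S {ω | X ω ≤ z} := fun S _ z => by
    rw [← prob_compl_eq_one_sub (hms z)]
    congr 1
    ext
    simp
  -- the tails of `X` under `Q₁` and under `Q` are compared at each level
  have hpt : ∀ z, 0 < z →
      Q₁ {ω | z < X ω} + (Ico z₀ η).indicator (fun _ => ENNReal.ofReal (c / 2)) z
      ≤ Q {ω | z < X ω} + (Ioo 0 z₀).indicator 1 z := by
    intro z hz
    rcases lt_or_ge z z₀ with h | h
    · rw [indicator_of_notMem (fun hm => hm.1.not_gt h), add_zero,
        indicator_of_mem (show z ∈ Ioo 0 z₀ from ⟨hz, h⟩)]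
      exact prob_le_one.trans (by simp)
    · rw [indicator_of_notMem (fun hm => hm.2.not_ge h) (1 : ℝ → ℝ≥0∞), add_zero]
      rcases lt_or_ge z η with h' | h'
      · rw [indicator_of_mem (show z ∈ Ico z₀ η from ⟨h, h'⟩), hcompl, hcompl, hQ₁X' z h]
        calc 1 - ENNReal.ofReal (ψ (P.real {ω | X ω ≤ z})) + ENNReal.ofReal (c / 2)
            ≤ 1 - ENNReal.ofReal c + ENNReal.ofReal (c / 2) := by
              gcongr
              exact hc _ (hP' z hz)
          _ = 1 - ENNReal.ofReal (c / 2) := by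
              rw [← ENNReal.ofReal_one, ← ENNReal.ofReal_sub _ hc0.le,
                ← ENNReal.ofReal_sub _ (half_pos hc0).le,
                ← ENNReal.ofReal_add (by linarith) (half_pos hc0).le]
              congr 1
              ring
          _ ≤ 1 - Q {ω | X ω ≤ z} := by
              refine tsub_le_tsub_left (le_trans (measure_mono ?_) hη) _
              exact fun ω hω => (show X ω ≤ _ from hω).trans h'.le
      · rw [indicator_of_notMem (fun hm => hm.2.not_ge h'), add_zero, hcompl, hcompl, hQ₁X' z h]
        exact tsub_le_tsub_left (ψ.apply_le_of_mem_determiningSet hQ _) _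
  have hlayer : ∀ S : Measure Ω, ∫⁻ ω, ENNReal.ofReal (X ω) ∂S = ∫⁻ z in Ioi 0, S {ω | z < X ω} :=
    fun S => lintegral_eq_lintegral_meas_lt S (.of_forall fun ω => (hX0 ω).le) hX.aemeasurable
  have hmean : ∀ S : Measure Ω,
      extendedMean S X = ((∫⁻ ω, ENNReal.ofReal (X ω) ∂S : ℝ≥0∞) : EReal) := fun S => by
    have : ∀ ω, ENNReal.ofReal (-X ω) = 0 := fun ω =>
      ENNReal.ofReal_eq_zero.2 (neg_nonpos.2 (hX0 ω).le)
    simp [extendedMean, this]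
  have hle := hmin Q₁ (determiningSet_mono (linearize_le (hP' z₀ hz₀)) hQ₁)
  rw [hmean, hmean, EReal.coe_ennreal_le_coe_ennreal_iff] at hle
  have hfin : ∫⁻ ω, ENNReal.ofReal (X ω) ∂Q₁ ≠ ∞ := by
    refine ne_top_of_le_ne_top ENNReal.one_ne_top
      ((lintegral_mono (g := fun _ => 1) fun ω => ?_).trans ?_)
    · exact ENNReal.ofReal_le_one.2 (hX1 ω)
    · simp
  have hint := setLIntegral_mono' (μ := volume) measurableSet_Ioi hpt
  have hz₀η : z₀ ≤ η := by
    simp only [z₀]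
    nlinarith
  rw [lintegral_add_right _ (measurable_const.indicator measurableSet_Ico),
    lintegral_add_right _ (measurable_one.indicator measurableSet_Ioo), ← hlayer, ← hlayer,
    setLIntegral_indicator measurableSet_Ico, setLIntegral_indicator measurableSet_Ioo,
    inter_eq_left.2 (show Ico z₀ η ⊆ Ioi 0 from fun z hz => hz₀.trans_le hz.1),
    inter_eq_left.2 (show Ioo 0 z₀ ⊆ Ioi 0 from fun z hz => hz.1), setLIntegral_const] at hint
  simp only [Pi.one_apply, setLIntegral_one, Real.volume_Ico, Real.volume_Ioo, sub_zero] at hint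
  have hfinal := (ENNReal.add_le_add_iff_left hfin).1 (hint.trans (add_le_add_left hle _))
  rw [← ENNReal.ofReal_mul (half_pos hc0).le, ENNReal.ofReal_le_ofReal_iff (by linarith)] at hfinal
  have h8 : 8 * z₀ = η * c := by simp only [z₀]; ring
  have : z₀ * c ≤ z₀ * 1 := mul_le_mul_of_nonneg_left hc1 hz₀.le
  nlinarith

end ConcaveDistortion

theorem DistortionSemigroup.tendsto_zero_of_pos (Ψ : DistortionSemigroup) {t : ℝ≥0} (ht : 0 < t)
    (h : Tendsto (Ψ t) (𝓝[>] 0) (𝓝 0)) (s : ℝ≥0) : Tendsto (Ψ s) (𝓝[>] 0) (𝓝 0) := by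
  have hself : Tendsto (Ψ t) (𝓝[>] 0) (𝓝[>] 0) := by
    refine tendsto_nhdsWithin_iff.2 ⟨h, ?_⟩
    filter_upwards [Ioc_mem_nhdsGT one_pos] with x hx
    exact hx.1.trans_le ((Ψ t).le_apply (Ioc_subset_Icc_self hx))
  have hn : ∀ n : ℕ, Tendsto (Ψ ((n + 1 : ℕ) * t)) (𝓝[>] 0) (𝓝 0) := fun n => by
    induction n with
    | zero => simpa using h
    | succ n ih =>
      refine (ih.comp hself).congr' ?_
      filter_upwards [Ioc_mem_nhdsGT one_pos] with x hx
      rw [Function.comp, ← Ψ.add_apply _ _ (Ioc_subset_Icc_self hx)]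
      congr 2
      push_cast
      ring
  obtain ⟨n, hn'⟩ := exists_nat_ge (s / t)
  have hsn : s ≤ (n + 1 : ℕ) * t :=
    ((div_le_iff₀ ht).1 hn').trans (by gcongr; simp)
  refine tendsto_of_tendsto_of_tendsto_of_le_of_le' tendsto_const_nhds (hn n) ?_ ?_
  · filter_upwards [Ioc_mem_nhdsGT one_pos] with x hx using (Ψ s).nonneg (Ioc_subset_Icc_self hx)
  · filter_upwards [Ioc_mem_nhdsGT one_pos] with x hx
      using Ψ.monotone_time (Ioc_subset_Icc_self hx) hsn

/-- If the extreme measures always exist, then no `Ψ_t` jumps at `0`: otherwise `exp (-N)` with an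
unbounded `N ≥ 0` is bounded and has no extreme measure. -/
theorem DistortionSemigroup.tendsto_zero_of_nonempty_extremeMeasures {Ω : Type*}
    [MeasurableSpace Ω] {P : Measure Ω} [IsProbabilityMeasure P] (hP : IsAtomless P)
    (Ψ : DistortionSemigroup)
    (h : ∀ X ∈ Ψ.L1 P, ∀ t : ℝ≥0, (extremeMeasures ((Ψ t).determiningSet P) X).Nonempty)
    (t : ℝ≥0) : Tendsto (Ψ t) (𝓝[>] 0) (𝓝 0) := by
  by_contra hne
  obtain ⟨c, hc0, hc⟩ := (Ψ t).exists_pos_le_of_not_tendsto hne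
  obtain ⟨η, hη, hsum⟩ := ENNReal.exists_pos_sum_of_countable' (ε := 1) (by simp) ℕ
  obtain ⟨-, N, -, -, hN, hN0, -, hunb⟩ := hP.exists_unbounded hη (hsum.trans (by simp)).ne
  have hX : Measurable fun ω => Real.exp (-N ω) := by fun_prop
  have hX1 : ∀ ω, Real.exp (-N ω) ≤ 1 := fun ω =>
    Real.exp_le_one_iff.2 (neg_nonpos.2 (hN0 ω))
  refine ConcaveDistortion.not_nonempty_extremeMeasures hc0 hc hX (fun ω => Real.exp_pos _) hX1 ?_
    (h _ ⟨hX, fun s => ⟨?_, ?_⟩⟩ t)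
  · intro z hz
    obtain ⟨n, hn⟩ := exists_nat_ge (-Real.log z)
    refine (hunb n).trans_le (measure_mono fun ω hω => ?_)
    have hω : (n : ℝ) ≤ N ω := hω
    exact (Real.le_log_iff_exp_le hz).1 (by linarith)
  · exact ConcaveDistortion.bot_lt_distortedMean hX fun ω => (Real.exp_pos _).le
  · exact ConcaveDistortion.bot_lt_distortedMean hX.neg fun ω => neg_le_neg (hX1 ω)

/-! ### The equivalences -/

theorem proposition1 {Ω : Type*} [MeasurableSpace Ω] (P : Measure Ω) [IsProbabilityMeasure P]
    (hP : IsAtomless P) (Ψ : DistortionSemigroup) (hΨ : Ψ.IsNontrivial) :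
    (∀ x ∈ Ioo (0 : ℝ) 1, 0 < Ψ.generator x ∧
      Tendsto (fun t : ℝ≥0 => (Ψ t x - x) / (t : ℝ)) (𝓝[>] 0) (𝓝 (Ψ.generator x))) ∧
    ∀ ε ∈ Ioo (0 : ℝ) 1, List.TFAE [
      ∃ X : Ω → ℝ, Measurable X ∧ essInf (fun ω => (X ω : EReal)) P = ⊥ ∧ 0 < Ψ.index P X,
      ∀ X ∈ Ψ.L1 P, ∀ t : ℝ≥0, (extremeMeasures ((Ψ t).determiningSet P) X).Nonempty,
      ∀ t : ℝ≥0, Tendsto (Ψ t) (𝓝[>] 0) (𝓝 0),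
      ∫⁻ s in Ioo (0 : ℝ) ε, ENNReal.ofReal (1 / Ψ.generator s) = ∞] := by

  refine ⟨fun x hx => ⟨hΨ.generator_pos hx, hΨ.tendsto_generator hx⟩, fun ε hε => ?_⟩
  tfae_have 1 → 3 := by
    rintro ⟨X, hX, hinf, hpos⟩
    obtain ⟨t, ht⟩ := lt_iSup_iff.1 hpos
    obtain ⟨hmean, ht0⟩ := lt_iSup_iff.1 ht
    exact Ψ.tendsto_zero_of_pos (by exact_mod_cast ht0)
      (ConcaveDistortion.tendsto_zero_of_essInf_eq_bot hX hinf hmean)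
  tfae_have 3 → 1 := by
    intro h
    obtain ⟨X, hX, hinf, hmean⟩ := ConcaveDistortion.exists_essInf_eq_bot hP (h 1)
    refine ⟨X, hX, hinf, lt_of_lt_of_le zero_lt_one ?_⟩
    exact le_iSup₂_of_le (f := fun (t : ℝ≥0) (_ : 0 ≤ (Ψ t).distortedMean (P.map X)) => (t : ℝ≥0∞))
      1 hmean (by simp)
  tfae_have 3 → 2 := fun h X hX t =>
    ConcaveDistortion.nonempty_extremeMeasures ((Ψ t).continuousOn_Icc (h t)) hX.1
  tfae_have 2 → 3 := Ψ.tendsto_zero_of_nonempty_extremeMeasures hP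
  tfae_have 3 → 4 := fun h => hΨ.lintegral_eq_top h hε
  tfae_have 4 → 3 := hΨ.tendsto_zero hε
  tfae_finish
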